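/- **The problem.** An instance of hypergraph orientation under explorable uncertainty with predictions consists of a finite hypergraph $H=(V,E)$ with non-empty hyperedges, an open uncertainty interval $I_v=(L_v,U_v)$, $L_v<U_v$, for each $v\in V$, a predicted weight $\bar w_v\in I_v$, and a precise weight $w_v\in I_v$ that is unknown to the algorithm. A query of $v$ reveals $w_v$ and replaces $I_v$ by the trivial interval $[w_v]$, which has lower limit $w_v$. A hyperedge is *solved* if one of its vertices has minimum weight in it for all weight vectors consistent with the current intervals. A set $Q\subseteq V$ is *feasible* if querying $Q$ solves all hyperedges, and $|\mathrm{OPT}|$ is the minimum size of a feasible set. An algorithm queries vertices adaptively until the set of queried vertices is feasible. A randomized algorithm is a probability distribution over deterministic algorithms; it *achieves competitive ratio* $\rho$ (where $\rho$ may depend on the instance) if on every instance it always ends with a feasible query set and its expected number of queries is at most $\rho\cdot|\mathrm{OPT}|$ (so it makes no query if $|\mathrm{OPT}|=0$). The *hop distance* $k_h$ is the number of ordered pairs $(u,v)$ of distinct vertices such that $\bar w_v\le L_u<w_v$, $w_v\le L_u<\bar w_v$, $w_v<U_u\le\bar w_v$ or $\bar w_v<U_u\le w_v$. **Algorithm 1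 with integer parameter $g\ge 2$.** All notions refer to the current intervals. A vertex is *leftmost* in a set $S$ of vertices if it has minimum lower limit in $S$. A vertex $v$ is *known mandatory* if it is leftmost in a hyperedge $S$ that is not solved and $I_u\subseteq I_v$ for some $u\in S\setminus\{v\}$. A vertex is *prediction mandatory* if it belongs to every feasible query set of the current instance when the predictions of all vertices not queried yet are correct. Two distinct vertices form a *witness pair* if they lie in a common hyperedge that is not solved, their intervals intersect, and one of them is leftmost in that hyperedge. For unqueried $u\ne v$, $\bar w_u$ *enforces* $v$ if $\bar w_u\in I_v$ and $u,v$ lie in a hyperedge $S$ that is not solved, where $v$ is leftmost in $S$, or $u$ is leftmost in $S$ and $v$ is leftmost in $S\setminus\{u\}$. *Exhaust* means: while there is a known mandatory vertex, query one. The algorithm resolves its choices arbitrarily and works as follows. 1. Exhaust. 2. Repeat the following until there is no prediction mandatory vertex: (a) as long as there is a prediction mandatory vertex and fewer than $g-2$ of them have been queried in this step (a), query one of them and exhaust; (b) if there are distinct $u,v,w$ such that $\bar w_u$ enforces $v$ and $\{u,w\}$ is a witness pair, choose such $u,v,w$, query $u$ and $w$, and then query $v$ if the weight revealed by $u$ lies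 in $I_v$; otherwise, if there are $u,v$ such that $\bar w_u$ enforces $v$, query such a $v$; (c) exhaust. 3. Compute a minimum vertex cover of the graph on $V$ whose edges are the witness pairs, and query its vertices. 4. Exhaust, and stop. **Theorem.** For every real number $\gamma\ge 2$ there are a number $\xi$ with $0\le\xi\le\frac1{48}$ and, for each integer $g\ge2$, an implementation of Algorithm 1 with parameter $g$, such that the following randomized algorithm for hypergraph orientation under explorable uncertainty with predictions achieves competitive ratio $$\min\Bigl\{\Bigl(1+\frac1\gamma+\xi\Bigr)\Bigl(1+\frac{k_h}{|\mathrm{OPT}|}\Bigr),\ \gamma\Bigr\}:$$ it chooses $\lceil\gamma\rceil$ with probability $\gamma-\lfloor\gamma\rfloor$ and $\lfloor\gamma\rfloor$ otherwise, and then runs Algorithm 1 with the chosen integer as parameter. -/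

import Mathlib

open scoped ENNReal

universe u

noncomputable section

namespace HypOrient

open scoped Classical

/-- What is given to an algorithm for hypergraph orientation under uncertainty with predictions:
a hypergraph on the finite vertex set `V`, an open uncertainty interval `(L v, U v)` for each
vertex, and a predicted weight in that interval. The precise weights are not part of it. -/
structure Input (V : Type u) where
  edges : Finset (Finset V)
  edges_nonempty : ∀ S ∈ edges, S.Nonempty
  L : V → ℝ
  U : V → ℝ
  L_lt_U : ∀ v, L v < U v
  pred : V → ℝ
  pred_mem : ∀ v, pred v ∈ Set.Ioo (L v) (U v)

/-- `w` is an admissible vector of precise weights. -/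
def IsRealization {V : Type u} (I : Input V) (w : V → ℝ) : Prop :=
  ∀ v, w v ∈ Set.Ioo (I.L v) (I.U v)

/-! ### Current instances -/

/-- The information gathered so far: `some x` for a vertex whose query returned the precise
weight `x`, and `none` for a vertex that has not been queried. -/
abbrev Known (V : Type u) := V → Option ℝ

/-- The state of information before the first query. -/
def Known.initial (V : Type u) : Known V := fun _ => none

/-- The state after the query of `v` returned `x`. -/
def Known.update {V : Type u} (K : Known V) (v : V) (x : ℝ) : Known V :=
  fun z => if z = v then some x else K z

/-- The state after all vertices of `Q` have been queried, the precise weights being `w`. -/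
def Known.reveal {V : Type u} (K : Known V) (w : V → ℝ) (Q : Finset V) : Known V :=
  fun z => if z ∈ Q then some (w z) else K z

/-- The current uncertainty interval of `v`: `(L v, U v)` as long as `v` has not been queried
(non-trivial), and `{w v}` afterwards (trivial). -/
def ival {V : Type u} (I : Input V) (K : Known V) (v : V) : Set ℝ :=
  match K v with
  | none => Set.Ioo (I.L v) (I.U v)
  | some x => {x}

/-- The lower limit of the current uncertainty interval of `v`. -/
def lowerLimit {V : Type u} (I : Input V) (K : Known V) (v : V) : ℝ := (K v).getD (I.L v)

/-- The orientation of `S` is known: some vertex of `S` has minimum weight in `S` for all weight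
vectors that are consistent with the current uncertainty intervals. -/
def Solved {V : Type u} (I : Input V) (K : Known V) (S : Finset V) : Prop :=
  ∃ v ∈ S, ∀ w' : V → ℝ, (∀ z, w' z ∈ ival I K z) → ∀ z ∈ S, w' v ≤ w' z

/-- `Q` is a feasible query set for the current instance when the precise weights are `w`. -/
def FeasibleFrom {V : Type u} (I : Input V) (K : Known V) (w : V → ℝ) (Q : Finset V) : Prop :=
  ∀ S ∈ I.edges, Solved I (K.reveal w Q) S

/-- `Q` is a feasible query set for the precise weights `w`. -/
def Feasible {V : Type u} (I : Input V) (w : V → ℝ) (Q : Finset V) : Prop :=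
  FeasibleFrom I (Known.initial V) w Q

/-- `|OPT|`, the minimum size of a feasible query set. -/
def optCard {V : Type u} (I : Input V) (w : V → ℝ) : ℕ :=
  sInf {n | ∃ Q : Finset V, Feasible I w Q ∧ Q.card = n}

/-! ### Hop distance -/

/-- The weight of `v` and its prediction lie in different positions relative to the interval of
`z`, that is, `k_z(v) = 1`. -/
def Hops {V : Type u} (I : Input V) (w : V → ℝ) (z v : V) : Prop :=
  (I.pred v ≤ I.L z ∧ I.L z < w v) ∨ (w v ≤ I.L z ∧ I.L z < I.pred v) ∨
  (w v < I.U z ∧ I.U z ≤ I.pred v) ∨ (I.pred v < I.U z ∧ I.U z ≤ w v)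

/-- The hop distance `k_h`. -/
def hopDistance {V : Type u} [Fintype V] (I : Input V) (w : V → ℝ) : ℕ :=
  ∑ v : V, ∑ z ∈ Finset.univ.erase v, if Hops I w z v then 1 else 0

/-! ### Adaptive deterministic and randomized algorithms -/

/-- An adaptive query strategy: either stop, or query a vertex and continue depending on the
precise weight that the query reveals. -/
inductive QueryTree (V : Type u) : Type u
  | halt : QueryTree V
  | query (v : V) (next : ℝ → QueryTree V) : QueryTree V

/-- The sequence of queries that are made when the precise weights are `w`. -/
def QueryTree.run {V : Type u} (w : V → ℝ) : QueryTree V → List V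
  | .halt => []
  | .query v next => v :: (next (w v)).run w

/-- A deterministic algorithm prescribes an adaptive query strategy for each input. -/
def DetAlg : Type (u + 1) := ∀ (V : Type u) [Fintype V], Input V → QueryTree V

/-- A randomized algorithm is a probability distribution on deterministic algorithms. -/
abbrev RandAlg : Type (u + 1) := PMF DetAlg.{u}

/-- The expected number of queries of a randomized algorithm. -/
def RandAlg.expectedQueries (R : RandAlg.{u}) {V : Type u} [Fintype V] (I : Input V)
    (w : V → ℝ) : ℝ≥0∞ :=
  ∑' a : DetAlg.{u}, R a * (((a V I).run w).length : ℝ≥0∞)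

/-- `R` solves every instance, whatever the outcome of its random choices, and its expected number
of queries is at most `ρ V I w * |OPT|` for every input `I` on a finite vertex set `V` and all
precise weights `w`. -/
def RandAlg.AchievesRatio (R : RandAlg.{u})
    (ρ : ∀ (V : Type u) [Fintype V], Input V → (V → ℝ) → ℝ) : Prop :=
  ∀ (V : Type u) [Fintype V] (I : Input V) (w : V → ℝ), IsRealization I w →
    (∀ a ∈ R.support, Feasible I w ((a V I).run w).toFinset) ∧
    R.expectedQueries I w ≤ ENNReal.ofReal (ρ V I w * (optCard I w : ℝ))

/-! ### Notions used by the algorithm, all for the current instance -/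

/-- `v` is leftmost in `S`: it has minimum lower limit in `S`. -/
def Leftmost {V : Type u} (I : Input V) (K : Known V) (S : Finset V) (v : V) : Prop :=
  v ∈ S ∧ ∀ z ∈ S, lowerLimit I K v ≤ lowerLimit I K z

/-- `v` is known to be mandatory: it is leftmost in a hyperedge that is not yet solved, and its
interval contains the revealed weight or the whole interval of another vertex of that
hyperedge. -/
def KnownMandatory {V : Type u} (I : Input V) (K : Known V) (v : V) : Prop :=
  ∃ S ∈ I.edges, ¬ Solved I K S ∧ Leftmost I K S v ∧ ∃ z ∈ S, z ≠ v ∧ ival I K z ⊆ ival I K v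

/-- `v` belongs to every feasible query set of the current instance if the precise weights
are `w`. -/
def Mandatory {V : Type u} (I : Input V) (K : Known V) (w : V → ℝ) (v : V) : Prop :=
  ∀ Q : Finset V, FeasibleFrom I K w Q → v ∈ Q

/-- `v` is prediction mandatory: it is mandatory if the predicted weights of all vertices that have
not been queried yet are correct. -/
def PredMandatory {V : Type u} (I : Input V) (K : Known V) (v : V) : Prop :=
  Mandatory I K (fun z => (K z).getD (I.pred z)) v

/-- `y` and `z` are two vertices of a not yet solved hyperedge with intersecting intervals, one of
them leftmost. Such pairs are the witness pairs that the algorithm uses. -/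
def WitnessPair {V : Type u} (I : Input V) (K : Known V) (y z : V) : Prop :=
  y ≠ z ∧ ∃ S ∈ I.edges, ¬ Solved I K S ∧ y ∈ S ∧ z ∈ S ∧
    (ival I K y ∩ ival I K z).Nonempty ∧ (Leftmost I K S y ∨ Leftmost I K S z)

/-- The predicted weight of `y` enforces `v`. -/
def Enforces {V : Type u} (I : Input V) (K : Known V) (y v : V) : Prop :=
  y ≠ v ∧ K y = none ∧ K v = none ∧ I.pred y ∈ ival I K v ∧
    ∃ S ∈ I.edges, ¬ Solved I K S ∧ y ∈ S ∧ v ∈ S ∧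
      (Leftmost I K S v ∨ (Leftmost I K S y ∧ Leftmost I K (S.erase y) v))

/-- The vertex cover instance; its edges are the pairs described in `WitnessPair`. -/
def vcGraph {V : Type u} (I : Input V) (K : Known V) : SimpleGraph V where
  Adj y z := WitnessPair I K y z
  symm := ⟨fun _ _ h => by
    obtain ⟨hne, S, hS, hn, hy, hz, hi, hl⟩ := h
    exact ⟨hne.symm, S, hS, hn, hz, hy, by rwa [Set.inter_comm], hl.symm⟩⟩
  loopless := ⟨fun _ h => h.1 rfl⟩

/-- `C` is a minimum vertex cover of `G`. -/
def IsMinVertexCover {V : Type u} (G : SimpleGraph V) (C : Finset V) : Prop :=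
  G.IsVertexCover (C : Set V) ∧ ∀ D : Finset V, G.IsVertexCover (D : Set V) → C.card ≤ D.card

/-! ### The algorithm -/

/-- Control states of the algorithm.
* `exhaust s`: query known mandatory vertices as long as there is one, then go to `s`;
* `collect q`: the while loop that queries up to `g - 2` prediction mandatory vertices, of which
  `q` have been queried in the current iteration of the repeat loop;
* `pairs`: the search for a triple or a pair with an enforced vertex;
* `single v`: query `v`, query known mandatory vertices exhaustively, and go to the test at the
  end of the repeat loop;
* `test`: that test;
* `cover`: compute a minimum vertex cover;
* `sweep C`: query the vertices of `C`, then the known mandatory vertices, and stop;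
* `finish`: stop. -/
inductive Stage (V : Type u) : Type u
  | exhaust (s : Stage V)
  | collect (q : ℕ)
  | pairs
  | single (v : V)
  | test
  | cover
  | sweep (C : Finset V)
  | finish

/-- `Follows I g s K t`: the query strategy `t` carries out the algorithm with the integer parameter
`g` on the input `I`, from the control state `s` and the state of information `K` on, with some
admissible resolution of all choices that the algorithm leaves open. -/
inductive Follows {V : Type u} (I : Input V) (g : ℕ) :
    Stage V → Known V → QueryTree V → Prop
  | exhaust_query {s : Stage V} {K : Known V} (v : V) (next : ℝ → QueryTree V)
      (hv : KnownMandatory I K v)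
      (h : ∀ x ∈ Set.Ioo (I.L v) (I.U v), Follows I g (.exhaust s) (K.update v x) (next x)) :
      Follows I g (.exhaust s) K (.query v next)
  | exhaust_done {s : Stage V} {K : Known V} {t : QueryTree V}
      (hK : ∀ v, ¬ KnownMandatory I K v) (h : Follows I g s K t) :
      Follows I g (.exhaust s) K t
  | collect_query {q : ℕ} {K : Known V} (v : V) (next : ℝ → QueryTree V)
      (hq : q + 2 < g) (hv : PredMandatory I K v)
      (h : ∀ x ∈ Set.Ioo (I.L v) (I.U v),
        Follows I g (.exhaust (.collect (q + 1))) (K.update v x) (next x)) :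
      Follows I g (.collect q) K (.query v next)
  | collect_done {q : ℕ} {K : Known V} {t : QueryTree V}
      (hq : g ≤ q + 2 ∨ ∀ v, ¬ PredMandatory I K v) (h : Follows I g .pairs K t) :
      Follows I g (.collect q) K t
  | pairs_triple {K : Known V} (y v z : V) (next : ℝ → ℝ → QueryTree V)
      (hv : Enforces I K y v) (hz : WitnessPair I K y z) (hvz : v ≠ z)
      (hin : ∀ x ∈ Set.Ioo (I.L y) (I.U y), ∀ x' ∈ Set.Ioo (I.L z) (I.U z), x ∈ ival I K v →
        Follows I g (.single v) ((K.update y x).update z x') (next x x'))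
      (hout : ∀ x ∈ Set.Ioo (I.L y) (I.U y), ∀ x' ∈ Set.Ioo (I.L z) (I.U z), x ∉ ival I K v →
        Follows I g (.exhaust .test) ((K.update y x).update z x') (next x x')) :
      Follows I g .pairs K (.query y fun x => .query z fun x' => next x x')
  | pairs_pair {K : Known V} {t : QueryTree V} (y v : V)
      (hno : ∀ y v z, Enforces I K y v → WitnessPair I K y z → v = z)
      (hv : Enforces I K y v) (h : Follows I g (.single v) K t) :
      Follows I g .pairs K t
  | pairs_none {K : Known V} {t : QueryTree V}
      (hno : ∀ y v, ¬ Enforces I K y v) (h : Follows I g (.exhaust .test) K t) :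
      Follows I g .pairs K t
  | single_query {K : Known V} (v : V) (next : ℝ → QueryTree V)
      (h : ∀ x ∈ Set.Ioo (I.L v) (I.U v),
        Follows I g (.exhaust .test) (K.update v x) (next x)) :
      Follows I g (.single v) K (.query v next)
  | test_repeat {K : Known V} {t : QueryTree V} (v : V) (hv : PredMandatory I K v)
      (h : Follows I g (.collect 0) K t) :
      Follows I g .test K t
  | test_exit {K : Known V} {t : QueryTree V} (hK : ∀ v, ¬ PredMandatory I K v)
      (h : Follows I g .cover K t) :
      Follows I g .test K t
  | cover {K : Known V} {t : QueryTree V} (C : Finset V) (hC : IsMinVertexCover (vcGraph I K) C)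
      (h : Follows I g (.sweep C) K t) :
      Follows I g .cover K t
  | sweep_query {C : Finset V} {K : Known V} (v : V) (next : ℝ → QueryTree V) (hv : v ∈ C)
      (h : ∀ x ∈ Set.Ioo (I.L v) (I.U v),
        Follows I g (.sweep (C.erase v)) (K.update v x) (next x)) :
      Follows I g (.sweep C) K (.query v next)
  | sweep_done {K : Known V} {t : QueryTree V} (h : Follows I g (.exhaust .finish) K t) :
      Follows I g (.sweep ∅) K t
  | finish {K : Known V} : Follows I g .finish K .halt

/-- `A` is an implementation of the algorithm with the integer parameter `g`. -/
def Implements (g : ℕ) (A : DetAlg.{u}) : Prop :=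
  ∀ (V : Type u) [Fintype V] (I : Input V),
    Follows I g (.exhaust (.collect 0)) (Known.initial V) (A V I)

/-- A biased coin that shows `true` with probability the fractional part of `γ`. -/
def fractCoin (γ : ℝ) : PMF Bool :=
  PMF.ofFintype (fun b => ENNReal.ofReal (if b then Int.fract γ else 1 - Int.fract γ)) (by
    have h0 := Int.fract_nonneg γ
    have h1 := (Int.fract_lt_one γ).le
    simp only [Fintype.sum_bool, if_true, Bool.false_eq_true, if_false]
    rw [← ENNReal.ofReal_add h0 (by linarith)]
    simp)

/-- The randomized algorithm that runs `A ⌈γ⌉` with probability the fractional part of `γ` and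
`A ⌊γ⌋` with the remaining probability. -/
def roundRandomly (A : ℕ → DetAlg.{u}) (γ : ℝ) : RandAlg.{u} :=
  (fractCoin γ).map fun b => A (if b then ⌈γ⌉₊ else ⌊γ⌋₊)

end HypOrient

end

noncomputable section

namespace HypOrient

open scoped Classical

/-! Two quantities of the current instance are followed along a run: the optimum `optFrom`, and the
potential `optFrom + hopFrom`, where `hopFrom` counts hops between unqueried vertices only. From
every state on, the number `c` of queries should satisfy `c ≤ g * opt` (robustness) and `g * c ≤ (g
+ 1) * potential` (consistency).

The basis is `MustQuery`: an unqueried `m` is mandatory exactly when, in some hyperedge, the least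
weight of the other vertices lies in the interval of `m`. This condition does not mention the state,
and it sees other weights only through their position relative to the two ends of that interval. So
predictions and truth can disagree on it only if some unqueried vertex hops over an end
(`exists_hops`). Hence querying a prediction mandatory vertex always lowers the potential: either it
is mandatory or a hop disappears (`PredMandatory.potential_update`).

Each of the up to `g - 2` queries that open an iteration thus leaves a surplus of `(g + 1) - g = 1`
in the consistency inequality. A triple with the third query costs three queries for two units of
optimum, a deficit of `3g - 2(g + 1) = g - 2`, which the surplus pays. A triple without it costs two
queries for one unit of optimum and one hop. If an enforced vertex is queried alone, the optimum
drops at once or a known mandatory vertex appears whose query lowers it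
(`Enforces.optFrom_update_or`). For robustness, all these queries are charged `g` to a unit of
optimum.

Once nothing is prediction mandatory, a minimum vertex cover costs at most the optimum. The later
queries are all mandatory, so their number is at most the optimum, and also at most the number of
hops, each of them being mispredicted. The result is feasible because an unsolved hyperedge would
yield a witness pair that existed before the cover was computed.

Random rounding gives mean `γ` for `g`, and mean `1 / γ` plus a small excess for `1 / g`. -/

variable {V : Type u} {I : Input V} {K K' : Known V} {w : V → ℝ} {S : Finset V}

/-! ### Current intervals -/

/-- The upper limit of the current uncertainty interval of `v`. -/
def upperLimit (I : Input V) (K : Known V) (v : V) : ℝ := (K v).getD (I.U v)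

/-- The answers recorded in `K` are those given by `w`. -/
def Agrees (K : Known V) (w : V → ℝ) : Prop := ∀ z x, K z = some x → w z = x

/-- The weights known in `K`, completed by the predictions. -/
def guess (I : Input V) (K : Known V) : V → ℝ := fun z => (K z).getD (I.pred z)

/-- There is no known mandatory vertex. -/
def Exhausted (I : Input V) (K : Known V) : Prop := ∀ v, ¬ KnownMandatory I K v

lemma ival_none {v : V} (h : K v = none) : ival I K v = Set.Ioo (I.L v) (I.U v) := by
  simp [ival, h]

lemma ival_some {v : V} {x : ℝ} (h : K v = some x) : ival I K v = {x} := by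
  simp [ival, h]

lemma lowerLimit_none {v : V} (h : K v = none) : lowerLimit I K v = I.L v := by
  simp [lowerLimit, h]

lemma lowerLimit_some {v : V} {x : ℝ} (h : K v = some x) : lowerLimit I K v = x := by
  simp [lowerLimit, h]

lemma upperLimit_none {v : V} (h : K v = none) : upperLimit I K v = I.U v := by
  simp [upperLimit, h]

lemma upperLimit_some {v : V} {x : ℝ} (h : K v = some x) : upperLimit I K v = x := by
  simp [upperLimit, h]

lemma lowerLimit_le {v : V} {x : ℝ} (h : x ∈ ival I K v) : lowerLimit I K v ≤ x := by
  rcases hv : K v with _ | y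
  · rw [ival_none hv] at h; rw [lowerLimit_none hv]; exact h.1.le
  · rw [ival_some hv] at h; rw [lowerLimit_some hv]; exact (Set.mem_singleton_iff.1 h).ge

lemma le_upperLimit {v : V} {x : ℝ} (h : x ∈ ival I K v) : x ≤ upperLimit I K v := by
  rcases hv : K v with _ | y
  · rw [ival_none hv] at h; rw [upperLimit_none hv]; exact h.2.le
  · rw [ival_some hv] at h; rw [upperLimit_some hv]; exact (Set.mem_singleton_iff.1 h).le

lemma guess_mem (I : Input V) (K : Known V) (v : V) : guess I K v ∈ ival I K v := by
  rcases hv : K v with _ | y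
  · rw [ival_none hv]; simpa [guess, hv] using I.pred_mem v
  · rw [ival_some hv]; simp [guess, hv]

lemma agrees_guess (I : Input V) (K : Known V) : Agrees K (guess I K) := by
  intro z x h; simp [guess, h]

lemma Agrees.mem_ival (hK : Agrees K w) (hw : IsRealization I w) (v : V) : w v ∈ ival I K v := by
  rcases hv : K v with _ | y
  · rw [ival_none hv]; exact hw v
  · rw [ival_some hv]; simp [hK v y hv]

lemma Agrees.eq_some (hK : Agrees K w) {v : V} (h : K v ≠ none) : K v = some (w v) := by
  rcases hv : K v with _ | y
  · exact absurd hv h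
  · rw [hK v y hv]

lemma Agrees.isRealization_guess (hK : Agrees K w) (hw : IsRealization I w) :
    IsRealization I (guess I K) := by
  intro z
  rcases hz : K z with _ | y
  · simpa [guess, hz] using I.pred_mem z
  · simpa [guess, hz, ← hK z y hz] using hw z

/-! ### Solved hyperedges -/

lemma exists_lt_of_lowerLimit_lt {v z : V} (h : lowerLimit I K z < upperLimit I K v) :
    ∃ a ∈ ival I K v, ∃ b ∈ ival I K z, b < a := by
  have hLv := I.L_lt_U v
  have hLz := I.L_lt_U z
  obtain ⟨b, hb, hbv⟩ : ∃ b ∈ ival I K z, b < upperLimit I K v := by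
    rcases hz : K z with _ | y
    · rw [lowerLimit_none hz] at h
      obtain ⟨b, h1, h2⟩ := exists_between (lt_min hLz h)
      rw [ival_none hz]
      exact ⟨b, ⟨h1, (lt_min_iff.1 h2).1⟩, (lt_min_iff.1 h2).2⟩
    · rw [lowerLimit_some hz] at h
      exact ⟨y, by simp [ival_some hz], h⟩
  rcases hv : K v with _ | y
  · rw [upperLimit_none hv] at hbv
    obtain ⟨a, h1, h2⟩ := exists_between (max_lt hLv hbv)
    rw [ival_none hv]
    exact ⟨a, ⟨(max_lt_iff.1 h1).1, h2⟩, b, hb, (max_lt_iff.1 h1).2⟩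
  · rw [upperLimit_some hv] at hbv
    exact ⟨y, by simp [ival_some hv], b, hb, hbv⟩

/-- If the limits of `v` and `z` are in the wrong order, admissible weights for these two alone,
completed arbitrarily, refute `v`. Solvedness is thereby a comparison of end points. -/
lemma solved_iff : Solved I K S ↔
    ∃ v ∈ S, ∀ z ∈ S, z ≠ v → upperLimit I K v ≤ lowerLimit I K z := by
  constructor
  · rintro ⟨v, hv, h⟩
    refine ⟨v, hv, fun z hz hzv => ?_⟩
    by_contra! hlt
    obtain ⟨a, ha, b, hb, hba⟩ := exists_lt_of_lowerLimit_lt hlt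
    have := h (fun y => if y = v then a else if y = z then b else guess I K y) (fun y => by
      by_cases h1 : y = v
      · subst h1; simpa using ha
      · by_cases h2 : y = z
        · subst h2; simpa [h1] using hb
        · simpa [h1, h2] using guess_mem I K y) z hz
    simp only [if_true, if_neg hzv] at this
    exact absurd this (not_le.2 hba)
  · rintro ⟨v, hv, h⟩
    refine ⟨v, hv, fun w' hw' z hz => ?_⟩
    by_cases hzv : z = v
    · rw [hzv]
    · exact (le_upperLimit (hw' v)).trans ((h z hz hzv).trans (lowerLimit_le (hw' z)))

lemma Solved.mono (h : ∀ z, ival I K' z ⊆ ival I K z) (hS : Solved I K S) : Solved I K' S := by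
  obtain ⟨v, hv, hs⟩ := hS
  exact ⟨v, hv, fun w' hw' => hs w' fun z => h z (hw' z)⟩

lemma solved_congr (h : ∀ z ∈ S, K z = K' z) (hS : Solved I K S) : Solved I K' S := by
  rw [solved_iff] at hS ⊢
  obtain ⟨v, hv, hs⟩ := hS
  refine ⟨v, hv, fun z hz hzv => ?_⟩
  simpa [upperLimit, lowerLimit, h z hz, h v hv] using hs z hz hzv

lemma exists_leftmost (I : Input V) (K : Known V) (hS : S.Nonempty) : ∃ v, Leftmost I K S v := by
  obtain ⟨v, hv, h⟩ := S.exists_min_image (lowerLimit I K) hS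
  exact ⟨v, hv, h⟩

lemma Leftmost.eq_none {v : V} (h : Leftmost I K S v) (hS : ¬ Solved I K S) : K v = none := by
  by_contra hv
  obtain ⟨x, hx⟩ := Option.ne_none_iff_exists'.1 hv
  refine hS (solved_iff.2 ⟨v, h.1, fun z hz _ => ?_⟩)
  have := h.2 z hz
  rw [lowerLimit_some hx] at this
  rwa [upperLimit_some hx]

/-- Strictness comes from openness for an unqueried `y`. A revealed weight equal to the lower limit
of `v` would itself be leftmost and would solve the hyperedge. -/
lemma Leftmost.lt_of_mem_ival {v y : V} {x : ℝ} (h : Leftmost I K S v) (hS : ¬ Solved I K S)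
    (hy : y ∈ S) (hx : x ∈ ival I K y) : I.L v < x := by
  have hv := h.eq_none hS
  have hle := h.2 y hy
  rw [lowerLimit_none hv] at hle
  rcases hKy : K y with _ | b
  · rw [lowerLimit_none hKy] at hle
    rw [ival_none hKy] at hx
    exact hle.trans_lt hx.1
  · rw [lowerLimit_some hKy] at hle
    rw [ival_some hKy, Set.mem_singleton_iff] at hx
    subst hx
    refine hle.lt_of_ne fun heq => ?_
    have : Leftmost I K S y := ⟨hy, fun z hz => by
      have := h.2 z hz
      rwa [lowerLimit_none hv, heq, ← lowerLimit_some (I := I) hKy] at this⟩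
    rw [this.eq_none hS] at hKy
    cases hKy

lemma KnownMandatory.eq_none {v : V} (h : KnownMandatory I K v) : K v = none := by
  obtain ⟨S, -, hn, hl, -⟩ := h
  exact hl.eq_none hn

/-! ### Mandatory vertices -/

/-- `m` has to be queried when the precise weights are `w`, because the minimum weight of the other
vertices of some hyperedge lies in its interval. -/
def MustQuery (I : Input V) (w : V → ℝ) (m : V) : Prop :=
  ∃ S ∈ I.edges, m ∈ S ∧ (∀ z ∈ S, z ≠ m → I.L m < w z) ∧ ∃ z ∈ S, z ≠ m ∧ w z < I.U m

lemma reveal_of_mem {Q : Finset V} {z : V} (h : z ∈ Q) : K.reveal w Q z = some (w z) := by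
  simp [Known.reveal, h]

lemma reveal_of_notMem {Q : Finset V} {z : V} (h : z ∉ Q) : K.reveal w Q z = K z := by
  simp [Known.reveal, h]

lemma Agrees.reveal (hK : Agrees K w) (Q : Finset V) : Agrees (K.reveal w Q) w := by
  intro z x h
  by_cases hz : z ∈ Q
  · rw [reveal_of_mem hz] at h; exact Option.some.inj h
  · rw [reveal_of_notMem hz] at h; exact hK z x h

lemma reveal_eq_none {Q : Finset V} {z : V} : K.reveal w Q z = none ↔ z ∉ Q ∧ K z = none := by
  by_cases hz : z ∈ Q
  · simp [reveal_of_mem hz, hz]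
  · simp [reveal_of_notMem hz, hz]

lemma reveal_singleton (K : Known V) (w : V → ℝ) (v : V) :
    K.reveal w {v} = K.update v (w v) := by
  funext z
  by_cases h : z = v
  · subst h; simp [Known.reveal, Known.update]
  · simp [Known.reveal, Known.update, h]

lemma reveal_reveal (K : Known V) (w : V → ℝ) (P Q : Finset V) :
    (K.reveal w P).reveal w Q = K.reveal w (P ∪ Q) := by
  funext z
  simp only [Known.reveal, Finset.mem_union]
  by_cases hP : z ∈ P <;> by_cases hQ : z ∈ Q <;> simp [hP, hQ]

lemma ival_subset_of_agrees (hw : IsRealization I w) (hK : Agrees K w) (hK' : Agrees K' w)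
    (h : ∀ z, K' z = none → K z = none) (z : V) : ival I K' z ⊆ ival I K z := by
  by_cases hz : K' z = none
  · rw [ival_none hz, ival_none (h z hz)]
  · rw [ival_some (hK'.eq_some hz), Set.singleton_subset_iff]
    exact hK.mem_ival hw z

lemma Solved.of_agrees (hw : IsRealization I w) (hK : Agrees K w) (hK' : Agrees K' w)
    (h : ∀ z, K' z = none → K z = none) (hS : Solved I K S) : Solved I K' S :=
  hS.mono (ival_subset_of_agrees hw hK hK' h)

lemma MustQuery.exists_not_solved {m : V} (h : MustQuery I w m) (hw : IsRealization I w)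
    (hK : Agrees K w) (hm : K m = none) :
    ∃ S ∈ I.edges, m ∈ S ∧ (∀ z ∈ S, z ≠ m → I.L m < w z) ∧ (∃ z ∈ S, z ≠ m ∧ w z < I.U m) ∧
      ¬ Solved I K S := by
  obtain ⟨S, hS, hmS, h1, y, hy, hym, h2⟩ := h
  refine ⟨S, hS, hmS, h1, ⟨y, hy, hym, h2⟩, fun hs => ?_⟩
  obtain ⟨v, hv, hs⟩ := solved_iff.1 hs
  by_cases hvm : v = m
  · subst hvm
    have := hs y hy hym
    rw [upperLimit_none hm] at this
    exact absurd (this.trans (lowerLimit_le (hK.mem_ival hw y))) (not_le.2 h2)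
  · have := hs m hmS (Ne.symm hvm)
    rw [lowerLimit_none hm] at this
    exact absurd ((le_upperLimit (hK.mem_ival hw v)).trans this) (not_le.2 (h1 v hv hvm))

lemma MustQuery.mandatory {m : V} (h : MustQuery I w m) (hw : IsRealization I w)
    (hK : Agrees K w) (hm : K m = none) : Mandatory I K w m := by
  intro Q hQ
  by_contra hmQ
  obtain ⟨S, hS, -, -, -, hn⟩ := h.exists_not_solved hw (hK.reveal Q)
    (reveal_eq_none.2 ⟨hmQ, hm⟩)
  exact hn (hQ S hS)

lemma feasibleFrom_univ [Fintype V] (I : Input V) (K : Known V) (w : V → ℝ) :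
    FeasibleFrom I K w Finset.univ := by
  intro S hS
  obtain ⟨v, hv, h⟩ := S.exists_min_image w (I.edges_nonempty S hS)
  refine solved_iff.2 ⟨v, hv, fun z hz _ => ?_⟩
  rw [upperLimit_some (reveal_of_mem (Finset.mem_univ v)),
    lowerLimit_some (reveal_of_mem (Finset.mem_univ z))]
  exact h z hz

lemma feasibleFrom_erase_of_ne_none {Q : Finset V} {v : V} (hK : Agrees K w) (hv : K v ≠ none)
    (hQ : FeasibleFrom I K w Q) : FeasibleFrom I K w (Q.erase v) := by
  have : K.reveal w (Q.erase v) = K.reveal w Q := by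
    funext z
    by_cases hz : z = v
    · subst hz
      simp only [Known.reveal, Finset.notMem_erase, hK.eq_some hv, ite_self]
    · simp [Known.reveal, hz]
  intro S hS
  rw [this]
  exact hQ S hS

lemma Mandatory.eq_none [Fintype V] {v : V} (hK : Agrees K w) (h : Mandatory I K w v) :
    K v = none := by
  by_contra hv
  exact Finset.notMem_erase v _ (h _ (feasibleFrom_erase_of_ne_none hK hv (feasibleFrom_univ I K w)))

/-- Contrapositive: if the criterion fails, querying everything except `m` is feasible. In each
hyperedge either `m` lies below all others, or the lightest of the others is a certified minimum. -/
lemma Mandatory.mustQuery [Fintype V] {m : V} (hK : Agrees K w) (h : Mandatory I K w m) :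
    MustQuery I w m := by
  by_contra hn
  refine Finset.notMem_erase m Finset.univ (h _ fun S hS => ?_)
  have hm := h.eq_none hK
  have hKm : K.reveal w (Finset.univ.erase m) m = none := reveal_eq_none.2 ⟨by simp, hm⟩
  have hKz : ∀ z, z ≠ m → K.reveal w (Finset.univ.erase m) z = some (w z) := fun z hz =>
    reveal_of_mem (by simp [hz])
  rw [solved_iff]
  by_cases hmS : m ∈ S ∧ ∀ z ∈ S, z ≠ m → I.U m ≤ w z
  · refine ⟨m, hmS.1, fun z hz hzm => ?_⟩
    rw [upperLimit_none hKm, lowerLimit_some (hKz z hzm)]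
    exact hmS.2 z hz hzm
  · have hne : (S.erase m).Nonempty := by
      by_contra hemp
      rw [Finset.not_nonempty_iff_eq_empty, Finset.erase_eq_empty_iff] at hemp
      rcases hemp with rfl | rfl
      · exact Finset.not_nonempty_empty (I.edges_nonempty _ hS)
      · exact hmS ⟨by simp, by simp⟩
    obtain ⟨v, hv, hmin⟩ := (S.erase m).exists_min_image w hne
    rw [Finset.mem_erase] at hv
    refine ⟨v, hv.2, fun z hz hzv => ?_⟩
    rw [upperLimit_some (hKz v hv.1)]
    by_cases hzm : z = m
    · subst hzm
      rw [lowerLimit_none hKm]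
      by_contra! hlt
      refine hmS ⟨hz, fun y hy hyz => ?_⟩
      by_contra! hyU
      exact hn ⟨S, hS, hz, fun x hx hxz => hlt.trans_le (hmin x (Finset.mem_erase.2 ⟨hxz, hx⟩)),
        y, hy, hyz, hyU⟩
    · rw [lowerLimit_some (hKz z hzm)]
      exact hmin z (Finset.mem_erase.2 ⟨hzm, hz⟩)

lemma PredMandatory.eq_none [Fintype V] {v : V} (h : PredMandatory I K v) : K v = none :=
  Mandatory.eq_none (agrees_guess I K) h

lemma PredMandatory.mustQuery [Fintype V] {v : V} (h : PredMandatory I K v) :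
    MustQuery I (guess I K) v :=
  Mandatory.mustQuery (agrees_guess I K) h

lemma KnownMandatory.mustQuery {v : V} (h : KnownMandatory I K v) (hw : IsRealization I w)
    (hK : Agrees K w) : MustQuery I w v := by
  have hv := h.eq_none
  obtain ⟨S, hS, hn, hl, z, hz, hzv, hsub⟩ := h
  refine ⟨S, hS, hl.1, fun y hy _ => hl.lt_of_mem_ival hn hy (hK.mem_ival hw y), z, hz, hzv, ?_⟩
  have := hsub (hK.mem_ival hw z)
  rw [ival_none hv] at this
  exact this.2

/-! ### States without known mandatory vertices -/

lemma Leftmost.knownMandatory_of_some {a z : V} {x : ℝ} (h : Leftmost I K S a)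
    (hn : ¬ Solved I K S) (hS : S ∈ I.edges) (hz : z ∈ S) (hx : K z = some x) (hU : x < I.U a) :
    KnownMandatory I K a := by
  have ha := h.eq_none hn
  refine ⟨S, hS, hn, h, z, hz, fun e => ?_, ?_⟩
  · rw [e, ha] at hx; cases hx
  · rw [ival_some hx, ival_none ha, Set.singleton_subset_iff]
    exact ⟨h.lt_of_mem_ival hn hz (by simp [ival_some hx]), hU⟩

lemma Leftmost.knownMandatory_of_none {a z : V} (h : Leftmost I K S a)
    (hn : ¬ Solved I K S) (hS : S ∈ I.edges) (hz : z ∈ S) (hza : z ≠ a) (hx : K z = none)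
    (hU : I.U z ≤ I.U a) : KnownMandatory I K a := by
  have ha := h.eq_none hn
  refine ⟨S, hS, hn, h, z, hz, hza, ?_⟩
  have := h.2 z hz
  rw [lowerLimit_none ha, lowerLimit_none hx] at this
  rw [ival_none hx, ival_none ha]
  exact Set.Ioo_subset_Ioo this hU

lemma Exhausted.exists_inter {a : V} (hE : Exhausted I K) (hS : S ∈ I.edges)
    (hn : ¬ Solved I K S) (h : Leftmost I K S a) :
    ∃ z ∈ S, z ≠ a ∧ K z = none ∧ (ival I K a ∩ ival I K z).Nonempty := by
  have ha := h.eq_none hn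
  have : ∃ z ∈ S, z ≠ a ∧ lowerLimit I K z < I.U a := by
    by_contra! hc
    exact hn (solved_iff.2 ⟨a, h.1, fun z hz hza => by
      rw [upperLimit_none ha]; exact hc z hz hza⟩)
  obtain ⟨z, hz, hza, hlt⟩ := this
  have hzn : K z = none := by
    by_contra hc
    obtain ⟨x, hx⟩ := Option.ne_none_iff_exists'.1 hc
    rw [lowerLimit_some hx] at hlt
    exact hE a (h.knownMandatory_of_some hn hS hz hx hlt)
  refine ⟨z, hz, hza, hzn, ?_⟩
  have hle := h.2 z hz
  rw [lowerLimit_none hzn] at hlt hle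
  rw [lowerLimit_none ha] at hle
  obtain ⟨x, h1, h2⟩ := exists_between (lt_min hlt (I.L_lt_U z))
  rw [lt_min_iff] at h2
  rw [ival_none ha, ival_none hzn]
  exact ⟨x, ⟨hle.trans_lt h1, h2.1⟩, h1, h2.2⟩

lemma WitnessPair.symm {y z : V} (h : WitnessPair I K y z) : WitnessPair I K z y :=
  (vcGraph I K).symm.1 _ _ h

lemma Exhausted.witnessPair_eq_none {y z : V} (hE : Exhausted I K) (h : WitnessPair I K y z) :
    K y = none ∧ K z = none := by
  have key : ∀ {y z : V} {S : Finset V}, S ∈ I.edges → ¬ Solved I K S → z ∈ S →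
      (ival I K y ∩ ival I K z).Nonempty → Leftmost I K S y → K y = none ∧ K z = none := by
    intro y z S hS hn hz hi hl
    have hy := hl.eq_none hn
    refine ⟨hy, ?_⟩
    by_contra hc
    obtain ⟨x, hx⟩ := Option.ne_none_iff_exists'.1 hc
    obtain ⟨b, hb1, hb2⟩ := hi
    rw [ival_some hx, Set.mem_singleton_iff] at hb2
    rw [ival_none hy] at hb1
    subst hb2
    exact hE y (hl.knownMandatory_of_some hn hS hz hx hb1.2)
  obtain ⟨-, S, hS, hn, hy, hz, hi, hl | hl⟩ := h
  · exact key hS hn hz hi hl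
  · rw [Set.inter_comm] at hi
    exact (key hS hn hy hi hl).symm

/-- With both vertices unqueried, the leftmost one cannot be certified against the other, whose
interval it meets, and no third vertex can be certified, since its weight exceeds the leftmost lower
limit. -/
lemma Exhausted.witnessPair_mem {y z : V} {Q : Finset V} (hE : Exhausted I K)
    (hw : IsRealization I w) (hK : Agrees K w)
    (h : WitnessPair I K y z) (hQ : FeasibleFrom I K w Q) : y ∈ Q ∨ z ∈ Q := by
  have key : ∀ {y z : V} {S : Finset V}, S ∈ I.edges → ¬ Solved I K S → z ∈ S → K y = none →
      K z = none → (ival I K y ∩ ival I K z).Nonempty → Leftmost I K S y → y ≠ z →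
      y ∈ Q ∨ z ∈ Q := by
    intro y z S hS hn hz hyn hzn ⟨b, hb1, hb2⟩ hl hyz
    rw [ival_none hyn] at hb1
    rw [ival_none hzn] at hb2
    by_contra! hc
    have hy' := reveal_eq_none (w := w).2 ⟨hc.1, hyn⟩
    have hz' := reveal_eq_none (w := w).2 ⟨hc.2, hzn⟩
    obtain ⟨v, hv, hs⟩ := solved_iff.1 (hQ S hS)
    by_cases hvy : v = y
    · subst hvy
      have := hs z hz hyz.symm
      rw [upperLimit_none hy', lowerLimit_none hz'] at this
      linarith [hb1.2, hb2.1]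
    · have := hs y hl.1 (Ne.symm hvy)
      rw [lowerLimit_none hy'] at this
      have h1 := le_upperLimit ((hK.reveal Q).mem_ival hw v)
      linarith [hl.lt_of_mem_ival hn hv (hK.mem_ival hw v)]
  obtain ⟨hyn, hzn⟩ := hE.witnessPair_eq_none h
  obtain ⟨hne, S, hS, hn, hy, hz, hi, hl | hl⟩ := h
  · exact key hS hn hz hyn hzn hi hl hne
  · rw [Set.inter_comm] at hi
    exact (key hS hn hy hzn hyn hi hl hne.symm).symm

lemma Enforces.witnessPair {y v : V} (h : Enforces I K y v) : WitnessPair I K y v := by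
  obtain ⟨hne, hy, hv, hp, S, hS, hn, hyS, hvS, hl⟩ := h
  refine ⟨hne, S, hS, hn, hyS, hvS, ⟨I.pred y, ?_, hp⟩, ?_⟩
  · rw [ival_none hy]; exact I.pred_mem y
  · exact hl.elim Or.inr fun h => Or.inl h.1

lemma Enforces.mustQuery {y v : V} (h : Enforces I K y v) (hE : Exhausted I K)
    (hw : IsRealization I w) (hK : Agrees K w) (hy : w y ∈ ival I K v) : MustQuery I w v := by
  obtain ⟨hne, hyn, hvn, hp, S, hS, hn, hyS, hvS, hl⟩ := h
  rw [ival_none hvn] at hy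
  refine ⟨S, hS, hvS, fun z hz hzv => ?_, y, hyS, hne, hy.2⟩
  rcases hl with hl | ⟨hl, hl'⟩
  · exact hl.lt_of_mem_ival hn hz (hK.mem_ival hw z)
  · by_cases hzy : z = y
    · rw [hzy]; exact hy.1
    have hle := hl'.2 z (Finset.mem_erase.2 ⟨hzy, hz⟩)
    rw [lowerLimit_none hvn] at hle
    by_cases hzn : K z = none
    · rw [lowerLimit_none hzn] at hle
      exact hle.trans_lt (hw z).1
    · have hzs := hK.eq_some hzn
      rw [lowerLimit_some hzs] at hle
      by_contra! hc
      -- A revealed weight at or below the lower limit of `v` would lie in the interval of the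
      -- leftmost `y`, contrary to exhaustion.
      exact hE y (hl.knownMandatory_of_some hn hS hz hzs (by linarith [(hw y).2, hy.1]))

lemma Enforces.predMandatory {y v : V} (h : Enforces I K y v) (hE : Exhausted I K)
    (hw : IsRealization I w) (hK : Agrees K w) : PredMandatory I K v := by
  have hg := hK.isRealization_guess hw
  refine MustQuery.mandatory (h.mustQuery hE hg (agrees_guess I K) ?_) hg (agrees_guess I K) h.2.2.1
  simpa [h.2.1] using h.2.2.2.1

/-- The enforced vertex need not be `v`. If `v` is not leftmost, the leftmost `y` enforces the
leftmost vertex `b` of the rest: the prediction of `y` exceeds the lower limit of `v`, hence that of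
`b`, and exhaustion keeps it below the upper limit of `b`. -/
lemma PredMandatory.exists_enforces [Fintype V] {v : V} (h : PredMandatory I K v)
    (hE : Exhausted I K) (hw : IsRealization I w) (hK : Agrees K w) :
    ∃ y v', Enforces I K y v' := by
  have hvn := h.eq_none
  obtain ⟨S, hS, hvS, h1, ⟨z, hz, hzv, h2⟩, hn⟩ :=
    h.mustQuery.exists_not_solved (hK.isRealization_guess hw) (agrees_guess I K) hvn
  by_cases hl : Leftmost I K S v
  · have hzn : K z = none := by
      by_contra hc
      obtain ⟨x, hx⟩ := Option.ne_none_iff_exists'.1 hc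
      exact hE v (hl.knownMandatory_of_some hn hS hz hx (by simpa [guess, hx] using h2))
    refine ⟨z, v, hzv, hzn, hvn, ?_, S, hS, hn, hz, hvS, Or.inl hl⟩
    rw [ival_none hvn]
    have h3 := h1 z hz hzv
    simp only [guess, hzn, Option.getD_none] at h2 h3
    exact ⟨h3, h2⟩
  · obtain ⟨y, hy⟩ := exists_leftmost I K ⟨v, hvS⟩
    have hyn := hy.eq_none hn
    have hvy : v ≠ y := fun e => hl (e ▸ hy)
    obtain ⟨b, hb⟩ := exists_leftmost I K ⟨v, Finset.mem_erase.2 ⟨hvy, hvS⟩⟩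
    have hbS := Finset.mem_erase.1 hb.1
    have hlt : lowerLimit I K b < I.pred y := by
      have h3 := h1 y hy.1 hvy.symm
      simp only [guess, hyn, Option.getD_none] at h3
      have h4 := hb.2 v (Finset.mem_erase.2 ⟨hvy, hvS⟩)
      rw [lowerLimit_none hvn] at h4
      exact h4.trans_lt h3
    have hbn : K b = none := by
      by_contra hc
      obtain ⟨x, hx⟩ := Option.ne_none_iff_exists'.1 hc
      rw [lowerLimit_some hx] at hlt
      exact hE y (hy.knownMandatory_of_some hn hS hbS.2 hx (hlt.trans (I.pred_mem y).2))
    refine ⟨y, b, hbS.1.symm, hyn, hbn, ?_, S, hS, hn, hy.1, hbS.2, Or.inr ⟨hy, hb⟩⟩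
    rw [lowerLimit_none hbn] at hlt
    rw [ival_none hbn]
    refine ⟨hlt, ?_⟩
    by_contra! hc
    exact hE y (hy.knownMandatory_of_none hn hS hbS.2 hbS.1 hbn
      (hc.trans (I.pred_mem y).2.le))

/-- Leftmost vertices of unsolved hyperedges are inherited from earlier states. -/
lemma Exhausted.leftmost_of_extends {a : V} (hE : Exhausted I K) (hE' : Exhausted I K')
    (hw : IsRealization I w) (hK : Agrees K w) (hK' : Agrees K' w)
    (hext : ∀ z, K' z = none → K z = none) (hS : S ∈ I.edges) (hn' : ¬ Solved I K' S)
    (h : Leftmost I K' S a) : Leftmost I K S a := by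
  have hn : ¬ Solved I K S := fun hs => hn' (hs.of_agrees hw hK hK' hext)
  have han' := h.eq_none hn'
  have han := hext a han'
  obtain ⟨x, hx⟩ := exists_leftmost I K ⟨a, h.1⟩
  have hxn := hx.eq_none hn
  suffices hle : I.L a ≤ I.L x from ⟨h.1, fun z hz => by
    have := hx.2 z hz
    rw [lowerLimit_none hxn] at this
    rw [lowerLimit_none han]
    exact hle.trans this⟩
  by_contra! hlt
  have hxn' : K' x ≠ none := fun hc => by
    have := h.2 x hx.1
    rw [lowerLimit_none han', lowerLimit_none hc] at this
    linarith
  have hxs := hK'.eq_some hxn'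
  -- Otherwise the weight of `x` would make `a` known mandatory in `K'`. With this bound the
  -- interval of `a` lies inside that of `x`, so `x` was known mandatory in `K`.
  have hU : I.U a ≤ w x := by
    by_contra! hc
    exact hE' a (h.knownMandatory_of_some hn' hS hx.1 hxs hc)
  exact hE x (hx.knownMandatory_of_none hn hS h.1 (fun e => by rw [e] at hlt; exact lt_irrefl _ hlt)
    han (hU.trans (hw x).2.le))

/-- A leftmost vertex of an unsolved hyperedge meets another unqueried interval. By
`Exhausted.leftmost_of_extends` this pair was already a witness pair in `K`, so one of the two is in
the cover and has been queried. -/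
lemma Exhausted.solved_of_isVertexCover {C : Finset V} (hE : Exhausted I K)
    (hE' : Exhausted I K') (hw : IsRealization I w) (hK : Agrees K w) (hK' : Agrees K' w)
    (hC : (vcGraph I K).IsVertexCover (C : Set V))
    (hext : ∀ z, K' z = none → (K.reveal w C) z = none) (hS : S ∈ I.edges) : Solved I K' S := by
  by_contra hn'
  have hext' : ∀ z, K' z = none → K z = none := fun z hz => (reveal_eq_none.1 (hext z hz)).2
  obtain ⟨a, ha⟩ := exists_leftmost I K' (I.edges_nonempty S hS)
  obtain ⟨z, hz, hza, hzn, hi⟩ := hE'.exists_inter hS hn' ha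
  have han := ha.eq_none hn'
  have hadj : (vcGraph I K).Adj a z :=
    ⟨hza.symm, S, hS, fun hs => hn' (hs.of_agrees hw hK hK' hext'), ha.1, hz,
      by
        rw [ival_none han, ival_none hzn] at hi
        rwa [ival_none (hext' a han), ival_none (hext' z hzn)],
      Or.inl (hE.leftmost_of_extends hE' hw hK hK' hext' hS hn' ha)⟩
  rcases hC hadj with h | h
  · exact (reveal_eq_none.1 (hext a han)).1 (by simpa using h)
  · exact (reveal_eq_none.1 (hext z hzn)).1 (by simpa using h)

/-! ### Optimum and hop distance of the current instance -/

/-- The minimum size of a feasible query set for the current instance. -/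
def optFrom (I : Input V) (K : Known V) (w : V → ℝ) : ℕ :=
  sInf {n | ∃ Q : Finset V, FeasibleFrom I K w Q ∧ Q.card = n}

/-- The number of hops of unqueried vertices relative to intervals of unqueried vertices. -/
def hopFrom [Fintype V] (I : Input V) (K : Known V) (w : V → ℝ) : ℕ :=
  (Finset.univ.filter fun p : V × V =>
    p.1 ≠ p.2 ∧ K p.1 = none ∧ K p.2 = none ∧ Hops I w p.1 p.2).card

lemma update_self (K : Known V) (v : V) (x : ℝ) : K.update v x v = some x := by
  simp [Known.update]

lemma update_of_ne {v z : V} (h : z ≠ v) (x : ℝ) : K.update v x z = K z := by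
  simp [Known.update, h]

lemma update_eq_none {v z : V} {x : ℝ} : K.update v x z = none ↔ z ≠ v ∧ K z = none := by
  by_cases h : z = v
  · subst h; simp [update_self]
  · simp [update_of_ne h, h]

lemma Agrees.update (hK : Agrees K w) (v : V) : Agrees (K.update v (w v)) w := by
  rw [← reveal_singleton]; exact hK.reveal _

lemma FeasibleFrom.of_update {Q : Finset V} {v : V}
    (h : FeasibleFrom I (K.update v (w v)) w Q) : FeasibleFrom I K w (insert v Q) := by
  intro S hS
  have := h S hS
  rwa [← reveal_singleton, reveal_reveal, ← Finset.insert_eq] at this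

lemma FeasibleFrom.update {Q : Finset V} (h : FeasibleFrom I K w Q) (hw : IsRealization I w)
    (hK : Agrees K w) (v : V) : FeasibleFrom I (K.update v (w v)) w (Q.erase v) := by
  intro S hS
  refine (h S hS).of_agrees hw (hK.reveal _) ((hK.update v).reveal _) fun z hz => ?_
  rw [reveal_eq_none, update_eq_none, Finset.mem_erase] at hz
  exact reveal_eq_none.2 ⟨fun hc => hz.1 ⟨hz.2.1, hc⟩, hz.2.2⟩

lemma optFrom_le {Q : Finset V} (h : FeasibleFrom I K w Q) : optFrom I K w ≤ Q.card :=
  Nat.sInf_le ⟨Q, h, rfl⟩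

lemma exists_card_eq_optFrom [Fintype V] (I : Input V) (K : Known V) (w : V → ℝ) :
    ∃ Q : Finset V, FeasibleFrom I K w Q ∧ Q.card = optFrom I K w :=
  Nat.sInf_mem (s := {n | ∃ Q : Finset V, FeasibleFrom I K w Q ∧ Q.card = n})
    ⟨_, Finset.univ, feasibleFrom_univ I K w, rfl⟩

lemma hopFrom_update_le [Fintype V] (I : Input V) (K : Known V) (w : V → ℝ) (v : V) (x : ℝ) :
    hopFrom I (K.update v x) w ≤ hopFrom I K w := by
  refine Finset.card_le_card fun p hp => ?_
  simp only [Finset.mem_filter, Finset.mem_univ, true_and, update_eq_none] at hp ⊢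
  tauto

lemma hopFrom_update_lt [Fintype V] {p z v : V} (x : ℝ) (hpz : p ≠ z) (hp : K p = none)
    (hz : K z = none) (h : Hops I w p z) (hv : v = p ∨ v = z) :
    hopFrom I (K.update v x) w + 1 ≤ hopFrom I K w := by
  refine Finset.card_lt_card ⟨fun p hp => ?_, fun hc => ?_⟩
  · simp only [Finset.mem_filter, Finset.mem_univ, true_and, update_eq_none] at hp ⊢
    tauto
  · have := @hc (p, z) (by simp [hpz, hp, hz, h])
    simp only [Finset.mem_filter, Finset.mem_univ, true_and, update_eq_none] at this
    rcases hv with rfl | rfl <;> tauto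

/-! ### Wrong predictions -/

lemma MustQuery.of_not_hops {w' : V → ℝ} {m : V} (h : MustQuery I w m)
    (hlo : ∀ z, z ≠ m → I.L m < w z → I.L m < w' z)
    (hup : ∀ z, z ≠ m → w z < I.U m → w' z < I.U m) : MustQuery I w' m := by
  obtain ⟨S, hS, hmS, h1, y, hy, hym, h2⟩ := h
  exact ⟨S, hS, hmS, fun z hz hzm => hlo z hzm (h1 z hz hzm), y, hy, hym, hup y hym h2⟩

lemma exists_hops {m : V} (hK : Agrees K w)
    (h : ¬ (MustQuery I (guess I K) m ↔ MustQuery I w m)) :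
    ∃ z, m ≠ z ∧ K z = none ∧ Hops I w m z := by
  by_contra! hc
  have hpos : ∀ z, z ≠ m → (I.L m < guess I K z ↔ I.L m < w z) ∧
      (guess I K z < I.U m ↔ w z < I.U m) := by
    intro z hz
    by_cases hzn : K z = none
    · have hh := hc z hz.symm hzn
      simp only [Hops, not_or, not_and, not_le, not_lt] at hh
      have hg : guess I K z = I.pred z := by simp [guess, hzn]
      rw [hg]
      obtain ⟨h1, h2, h3, h4⟩ := hh
      refine ⟨⟨fun h => ?_, fun h => ?_⟩, fun h => h4 h, fun h => h3 h⟩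
      · by_contra! hn; linarith [h2 hn]
      · by_contra! hn; linarith [h1 hn]
    · have hg : guess I K z = w z := by simp [guess, hK.eq_some hzn]
      rw [hg]
      exact ⟨Iff.rfl, Iff.rfl⟩
  exact h ⟨fun h => h.of_not_hops (fun z hz => (hpos z hz).1.1) fun z hz => (hpos z hz).2.1,
    fun h => h.of_not_hops (fun z hz => (hpos z hz).1.2) fun z hz => (hpos z hz).2.2⟩

lemma Enforces.hops {y v : V} (h : Enforces I K y v) (hy : w y ∉ ival I K v) :
    Hops I w v y := by
  obtain ⟨-, -, hv, hp, -⟩ := h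
  rw [ival_none hv] at hp hy
  simp only [Set.mem_Ioo, not_and, not_lt] at hp hy
  by_cases h1 : I.L v < w y
  · exact Or.inr (Or.inr (Or.inr ⟨hp.2, hy h1⟩))
  · exact Or.inr (Or.inl ⟨not_lt.1 h1, hp.1⟩)

section Optimum

variable [Fintype V]

lemma optFrom_update_le (hw : IsRealization I w) (hK : Agrees K w) (v : V) :
    optFrom I (K.update v (w v)) w ≤ optFrom I K w := by
  obtain ⟨Q, hQ, hc⟩ := exists_card_eq_optFrom I K w
  rw [← hc]
  exact (optFrom_le (hQ.update hw hK v)).trans Finset.card_erase_le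

lemma MustQuery.optFrom_update {v : V} (h : MustQuery I w v) (hw : IsRealization I w)
    (hK : Agrees K w) (hv : K v = none) : optFrom I (K.update v (w v)) w + 1 ≤ optFrom I K w := by
  obtain ⟨Q, hQ, hc⟩ := exists_card_eq_optFrom I K w
  have hvQ := h.mandatory hw hK hv Q hQ
  have := optFrom_le (hQ.update hw hK v)
  have := Finset.card_erase_add_one hvQ
  omega

lemma optFrom_update_witnessPair {y z : V} (h : WitnessPair I K y z) (hE : Exhausted I K)
    (hw : IsRealization I w) (hK : Agrees K w) :
    optFrom I ((K.update y (w y)).update z (w z)) w + 1 ≤ optFrom I K w := by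
  obtain ⟨Q, hQ, hc⟩ := exists_card_eq_optFrom I K w
  have := optFrom_le ((hQ.update hw hK y).update hw (hK.update y) z)
  have h1 : ((Q.erase y).erase z).card + 1 ≤ Q.card := by
    refine Finset.card_lt_card ⟨fun x hx => ?_, fun hsub => ?_⟩
    · simp only [Finset.mem_erase] at hx; exact hx.2.2
    · rcases hE.witnessPair_mem hw hK h hQ with hm | hm
      · simpa using hsub hm
      · simpa using hsub hm
  omega

lemma solved_of_optFrom_eq_zero (h : optFrom I K w = 0) (hS : S ∈ I.edges) : Solved I K S := by
  obtain ⟨Q, hQ, hc⟩ := exists_card_eq_optFrom I K w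
  rw [h, Finset.card_eq_zero] at hc
  subst hc
  refine solved_congr (fun z _ => ?_) (hQ S hS)
  exact reveal_of_notMem (Finset.notMem_empty z)

lemma optFrom_pos (hS : S ∈ I.edges) (hn : ¬ Solved I K S) : 0 < optFrom I K w :=
  Nat.pos_of_ne_zero fun h => hn (solved_of_optFrom_eq_zero h hS)

lemma PredMandatory.optFrom_pos {v : V} (h : PredMandatory I K v) (hw : IsRealization I w)
    (hK : Agrees K w) : 0 < optFrom I K w := by
  obtain ⟨S, hS, -, -, -, hn⟩ := h.mustQuery.exists_not_solved (hK.isRealization_guess hw)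
    (agrees_guess I K) h.eq_none
  exact HypOrient.optFrom_pos hS hn

lemma WitnessPair.optFrom_pos {y z : V} (h : WitnessPair I K y z) : 0 < optFrom I K w := by
  obtain ⟨-, S, hS, hn, -⟩ := h
  exact HypOrient.optFrom_pos hS hn

/-- Every feasible set meets each witness pair, so it is itself a vertex cover. -/
lemma card_le_optFrom_of_isMinVertexCover {C : Finset V}
    (hC : IsMinVertexCover (vcGraph I K) C) (hE : Exhausted I K)
    (hw : IsRealization I w) (hK : Agrees K w) : C.card ≤ optFrom I K w := by
  obtain ⟨Q, hQ, hc⟩ := exists_card_eq_optFrom I K w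
  rw [← hc]
  exact hC.2 Q fun y z h => hE.witnessPair_mem hw hK h hQ

/-- The unqueried vertices that have to be queried. -/
def mustQueries (I : Input V) (K : Known V) (w : V → ℝ) : Finset V :=
  Finset.univ.filter fun m => K m = none ∧ MustQuery I w m

lemma card_mustQueries_le_optFrom (hw : IsRealization I w) (hK : Agrees K w) :
    (mustQueries I K w).card ≤ optFrom I K w := by
  obtain ⟨Q, hQ, hc⟩ := exists_card_eq_optFrom I K w
  rw [← hc]
  refine Finset.card_le_card fun m hm => ?_
  simp only [mustQueries, Finset.mem_filter, Finset.mem_univ, true_and] at hm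
  exact hm.2.mandatory hw hK hm.1 Q hQ

lemma mustQueries_reveal_subset (C : Finset V) :
    mustQueries I (K.reveal w C) w ⊆ mustQueries I K w := by
  intro m hm
  simp only [mustQueries, Finset.mem_filter, Finset.mem_univ, true_and, reveal_eq_none] at hm ⊢
  exact ⟨hm.1.2, hm.2⟩

lemma card_mustQueries_update {v : V} (hv : K v = none) (h : MustQuery I w v) (x : ℝ) :
    (mustQueries I (K.update v x) w).card + 1 = (mustQueries I K w).card := by
  have : mustQueries I (K.update v x) w = (mustQueries I K w).erase v := by
    ext m
    simp only [mustQueries, Finset.mem_filter, Finset.mem_univ, true_and, update_eq_none,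
      Finset.mem_erase]
    tauto
  rw [this]
  exact Finset.card_erase_add_one (by simp [mustQueries, hv, h])

/-! ### Decrease of the potential -/

lemma PredMandatory.potential_update {v : V} (h : PredMandatory I K v) (hw : IsRealization I w)
    (hK : Agrees K w) :
    optFrom I (K.update v (w v)) w + hopFrom I (K.update v (w v)) w + 1 ≤
      optFrom I K w + hopFrom I K w := by
  by_cases hm : MustQuery I w v
  · have := hm.optFrom_update hw hK h.eq_none
    have := hopFrom_update_le I K w v (w v)
    omega
  · obtain ⟨z, hvz, hz, hh⟩ := exists_hops hK (fun hc => hm (hc.1 h.mustQuery))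
    have := optFrom_update_le hw hK v
    have := hopFrom_update_lt (w v) hvz h.eq_none hz hh (Or.inl rfl)
    omega

/-- Each such vertex is mandatory but not predicted so, which yields a hop over its own interval;
hops for different vertices are different pairs. -/
lemma card_mustQueries_le_hopFrom (hw : IsRealization I w) (hK : Agrees K w)
    (hP : ∀ v, ¬ PredMandatory I K v) : (mustQueries I K w).card ≤ hopFrom I K w := by
  refine Finset.card_le_card_of_surjOn Prod.fst fun m hm => ?_
  simp only [mustQueries, Finset.coe_filter, Finset.mem_univ, true_and, Set.mem_ofPred_eq] at hm
  obtain ⟨z, hmz, hz, hh⟩ := exists_hops hK (m := m) (I := I) fun hc => hP m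
    ((hc.2 hm.2).mandatory (hK.isRealization_guess hw) (agrees_guess I K) hm.1)
  exact ⟨(m, z), by simpa using ⟨hmz, hm.1, hz, hh⟩, rfl⟩

/-! ### Single enforced vertices -/

/-- If an optimal `Q` omits `v`, it contains `y`. As `v` is the only witness partner of `y`, the
query of `v` makes `y` superfluous unless a new known mandatory vertex appears, so `Q.erase y` is
feasible afterwards. -/
lemma Enforces.optFrom_update_or {y v : V} (h : Enforces I K y v) (hE : Exhausted I K)
    (hno : ∀ z, WitnessPair I K y z → v = z) (hw : IsRealization I w) (hK : Agrees K w) :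
    optFrom I (K.update v (w v)) w + 1 ≤ optFrom I K w ∨
      ¬ Exhausted I (K.update v (w v)) := by
  rw [or_iff_not_imp_right, not_not]
  intro hE'
  obtain ⟨Q, hQ, hc⟩ := exists_card_eq_optFrom I K w
  by_cases hvQ : v ∈ Q
  · have := optFrom_le (hQ.update hw hK v)
    have := Finset.card_erase_add_one hvQ
    omega
  have hyQ : y ∈ Q := (hE.witnessPair_mem hw hK h.witnessPair hQ).resolve_right hvQ
  obtain ⟨hyv, hyn, hvn, -⟩ := h
  have hK' := hK.update v
  have hQ' := hQ.update hw hK v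
  rw [Finset.erase_eq_of_notMem hvQ] at hQ'
  suffices hf : FeasibleFrom I (K.update v (w v)) w (Q.erase y) by
    have := optFrom_le hf
    have := Finset.card_erase_add_one hyQ
    omega
  intro S hS
  by_cases hyS : y ∈ S
  swap
  · refine solved_congr (fun z hz => ?_) (hQ' S hS)
    have : z ≠ y := fun e => hyS (e ▸ hz)
    simp [Known.reveal, this]
  by_cases hn : Solved I (K.update v (w v)) S
  · exact hn.of_agrees hw hK' (hK'.reveal _) fun z hz => (reveal_eq_none.1 hz).2
  obtain ⟨a, ha⟩ := exists_leftmost I (K.update v (w v)) ⟨y, hyS⟩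
  have han' := ha.eq_none hn
  obtain ⟨hav, han⟩ := update_eq_none.1 han'
  have hext : ∀ z, K.update v (w v) z = none → K z = none := fun z hz => (update_eq_none.1 hz).2
  have haK := hE.leftmost_of_extends hE' hw hK hK' hext hS hn ha
  have hnK : ¬ Solved I K S := fun hs => hn (hs.of_agrees hw hK hK' hext)
  by_cases hay : a = y
  · subst hay
    obtain ⟨z, hz, hza, hzn, hi⟩ := hE'.exists_inter hS hn ha
    obtain ⟨hzv, hzn⟩ := update_eq_none.1 hzn
    simp only [ival, update_of_ne hav, update_of_ne hzv] at hi
    exact absurd (hno z ⟨hza.symm, S, hS, hnK, hyS, hz, hi, Or.inl haK⟩) hzv.symm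
  have hle : I.L a ≤ I.L y := by
    have := haK.2 y hyS
    rwa [lowerLimit_none han, lowerLimit_none hyn] at this
  -- Otherwise `a` would be a second witness partner of `y`. Thus `y` lies entirely to the right of
  -- `a` and cannot influence the minimum of `S`.
  have hU : I.U a ≤ I.L y := by
    by_contra! hlt
    obtain ⟨b, h1, h2⟩ := exists_between (lt_min hlt (I.L_lt_U y))
    rw [lt_min_iff] at h2
    exact hav (hno a ⟨Ne.symm hay, S, hS, hnK, hyS, ha.1, ⟨b, by
      rw [ival_none hyn, ival_none han]
      exact ⟨⟨h1, h2.2⟩, hle.trans_lt h1, h2.1⟩⟩, Or.inr haK⟩).symm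
  have hlow : lowerLimit I ((K.update v (w v)).reveal w Q) a ≤ w a :=
    lowerLimit_le ((hK'.reveal Q).mem_ival hw a)
  have hyval : (K.update v (w v)).reveal w Q y = some (w y) := reveal_of_mem hyQ
  have hyval' : (K.update v (w v)).reveal w (Q.erase y) y = none :=
    reveal_eq_none.2 ⟨Finset.notMem_erase y Q, update_eq_none.2 ⟨hyv, hyn⟩⟩
  have hsame : ∀ z, z ≠ y →
      (K.update v (w v)).reveal w (Q.erase y) z = (K.update v (w v)).reveal w Q z :=
    fun z hz => by simp [Known.reveal, hz]
  obtain ⟨x, hx, hs⟩ := solved_iff.1 (hQ' S hS)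
  have hxy : x ≠ y := by
    rintro rfl
    have := hs a ha.1 hay
    rw [upperLimit_some hyval] at this
    linarith [(hw a).2, (hw x).1]
  refine solved_iff.2 ⟨x, hx, fun z hz hzx => ?_⟩
  have hux : upperLimit I ((K.update v (w v)).reveal w (Q.erase y)) x =
      upperLimit I ((K.update v (w v)).reveal w Q) x := by
    simp only [upperLimit, hsame x hxy]
  rw [hux]
  by_cases hzy : z = y
  · subst hzy
    rw [lowerLimit_none hyval']
    by_cases hxa : x = a
    · subst hxa
      refine le_trans ?_ hU
      by_cases hxn : (K.update v (w v)).reveal w Q x = none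
      · rw [upperLimit_none hxn]
      · rw [upperLimit_some ((hK'.reveal Q).eq_some hxn)]
        exact (hw x).2.le
    · linarith [hs a ha.1 (Ne.symm hxa), (hw a).2]
  · have := hs z hz hzx
    simpa only [lowerLimit, hsame z hzy] using this

end Optimum

/-! ### Number of queries -/

/-- Both bounds on the number `c` of queries made from the test onwards, known mandatory vertices
being queried first. -/
structure TestBound [Fintype V] (I : Input V) (g : ℕ) (K : Known V) (w : V → ℝ) (c : ℕ) :
    Prop where
  robust : c ≤ g * optFrom I K w
  -- The pending known mandatory query lowers the optimum at a cost of one, so `g - 1` earlier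
  -- queries can still be charged to it.
  robust_exhaust : ¬ Exhausted I K → c + g ≤ g * optFrom I K w + 1
  -- Leaving the loop costs only twice the optimum, which leaves room for the `g - 2` queries of a
  -- last iteration.
  robust_exit : Exhausted I K → (∀ v, ¬ PredMandatory I K v) → 0 < optFrom I K w →
    c + g ≤ g * optFrom I K w + 2
  consistent : g * c ≤ (g + 1) * (optFrom I K w + hopFrom I K w)

/-- The bounds on the number `c` of queries that are made from the given control state onwards. -/
def StageBound [Fintype V] (I : Input V) (g : ℕ) (w : V → ℝ) (K : Known V) (c : ℕ) :
    Stage V → Prop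
  -- The `q` queries already made in this iteration are charged to a later drop of the optimum, and
  -- each has contributed one credit to the last inequality.
  | .exhaust (.collect q) => q + 2 ≤ g →
      c ≤ g * optFrom I K w ∧ (0 < optFrom I K w → c + q ≤ g * optFrom I K w) ∧
      g * c ≤ (g + 1) * (optFrom I K w + hopFrom I K w) + q
  | .collect q => Exhausted I K → q + 2 ≤ g →
      c ≤ g * optFrom I K w ∧ (0 < optFrom I K w → c + q ≤ g * optFrom I K w) ∧
      g * c ≤ (g + 1) * (optFrom I K w + hopFrom I K w) + q
  -- These are the bounds of `collect` with `q = g - 2`; no credit is needed when nothing is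
  -- prediction mandatory.
  | .pairs => Exhausted I K →
      c ≤ g * optFrom I K w ∧ (0 < optFrom I K w → c + g ≤ g * optFrom I K w + 2) ∧
      g * c + 2 ≤ (g + 1) * (optFrom I K w + hopFrom I K w) + g ∧
      ((∀ v, ¬ PredMandatory I K v) → g * c ≤ (g + 1) * (optFrom I K w + hopFrom I K w))
  | .single v => ∃ c', c = c' + 1 ∧ TestBound I g (K.update v (w v)) w c'
  | .exhaust .test => TestBound I g K w c
  | .test => Exhausted I K → TestBound I g K w c
  | .cover => Exhausted I K → (∀ v, ¬ PredMandatory I K v) →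
      c ≤ 2 * optFrom I K w ∧ c ≤ optFrom I K w + hopFrom I K w
  | .sweep C => c ≤ C.card + (mustQueries I (K.reveal w C) w).card
  | .exhaust .finish => c ≤ (mustQueries I K w).card
  | .finish => c = 0
  | _ => True

lemma StageBound.exhaust_query [Fintype V] {g : ℕ} {s : Stage V} {v : V} {c : ℕ} (hg : 2 ≤ g)
    (hw : IsRealization I w) (hK : Agrees K w) (hv : KnownMandatory I K v)
    (h : StageBound I g w (K.update v (w v)) c (.exhaust s)) :
    StageBound I g w K (c + 1) (.exhaust s) := by
  have hvn := hv.eq_none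
  have hm := hv.mustQuery hw hK
  have hopt := hm.optFrom_update hw hK hvn
  have hhop := hopFrom_update_le I K w v (w v)
  have h1 : g * optFrom I (K.update v (w v)) w + g ≤ g * optFrom I K w := by nlinarith
  have h2 : (g + 1) * (optFrom I (K.update v (w v)) w + hopFrom I (K.update v (w v)) w) + (g + 1) ≤
      (g + 1) * (optFrom I K w + hopFrom I K w) := by nlinarith
  cases s with
  | collect q =>
    simp only [StageBound] at h ⊢
    intro hq
    obtain ⟨ha, hb, hc⟩ := h hq
    -- Once the optimum is zero no query remains, and the last drop, worth `g`, covers this query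
    -- and the `q` earlier ones.
    refine ⟨by omega, fun _ => ?_, by rw [mul_add]; omega⟩
    rcases Nat.eq_zero_or_pos (optFrom I (K.update v (w v)) w) with h0 | h0
    · rw [h0] at ha h1; omega
    · have := hb h0; omega
  | test =>
    simp only [StageBound] at h ⊢
    obtain ⟨ha, hb, hc, hd⟩ := h
    exact ⟨by omega, fun _ => by omega, fun hE => absurd hv (hE v), by rw [mul_add]; omega⟩
  | finish =>
    simp only [StageBound] at h ⊢
    have := card_mustQueries_update hvn hm (w v)
    omega
  | _ => trivial

lemma StageBound.exhaust_done [Fintype V] {g : ℕ} {s : Stage V} {c : ℕ}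
    (hE : Exhausted I K) (h : StageBound I g w K c s) :
    StageBound I g w K c (.exhaust s) := by
  cases s with
  | collect q => exact h hE
  | test => exact h hE
  | finish => simp only [StageBound] at h ⊢; omega
  | _ => trivial

lemma StageBound.collect_query [Fintype V] {g q : ℕ} {v : V} {c : ℕ}
    (hw : IsRealization I w) (hK : Agrees K w) (hq : q + 2 < g) (hv : PredMandatory I K v)
    (h : StageBound I g w (K.update v (w v)) c (.exhaust (.collect (q + 1)))) :
    StageBound I g w K (c + 1) (.collect q) := by
  intro hE _
  obtain ⟨ha, hb, hc⟩ := h hq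
  have hopt := optFrom_update_le hw hK v
  have hpos := hv.optFrom_pos hw hK
  have hpot := hv.potential_update hw hK
  have h1 : g * optFrom I (K.update v (w v)) w ≤ g * optFrom I K w := Nat.mul_le_mul_left _ hopt
  have h3 : g ≤ g * optFrom I K w := Nat.le_mul_of_pos_right _ hpos
  have h2 := Nat.mul_le_mul_left (g + 1) hpot
  rw [mul_add (g + 1) _ 1] at h2
  have key : c + 1 + q ≤ g * optFrom I K w := by
    rcases Nat.eq_zero_or_pos (optFrom I (K.update v (w v)) w) with h0 | h0
    · rw [h0] at ha; omega
    · have := hb h0; omega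
  exact ⟨by omega, fun _ => key, by rw [mul_add g c]; omega⟩

lemma StageBound.collect_done [Fintype V] {g q : ℕ} {c : ℕ}
    (hq : g ≤ q + 2 ∨ ∀ v, ¬ PredMandatory I K v) (h : StageBound I g w K c .pairs) :
    StageBound I g w K c (.collect q) := by
  intro hE hqg
  obtain ⟨ha, hb, hc, hd⟩ := h hE
  refine ⟨ha, fun h0 => by have := hb h0; omega, ?_⟩
  rcases hq with hq | hq
  · omega
  · have := hd hq; omega

/-- The witness pair lowers the optimum by one. If the weight of `y` lies in the interval of `v`,
then `v` is mandatory and brings a second unit; otherwise `y` hops over the interval of `v`, and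
this hop disappears with the query of `y`. -/
lemma StageBound.pairs_triple [Fintype V] {g : ℕ} {y v z : V} {c : ℕ} (hg : 2 ≤ g)
    (hw : IsRealization I w) (hK : Agrees K w)
    (hv : Enforces I K y v) (hz : WitnessPair I K y z) (hvz : v ≠ z)
    (hin : w y ∈ ival I K v →
      StageBound I g w ((K.update y (w y)).update z (w z)) c (.single v))
    (hout : w y ∉ ival I K v →
      StageBound I g w ((K.update y (w y)).update z (w z)) c (.exhaust .test)) :
    StageBound I g w K (c + 2) .pairs := by
  intro hE
  have hpos : 0 < optFrom I K w := hz.optFrom_pos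
  have hwit := optFrom_update_witnessPair hz hE hw hK
  have hh1 := hopFrom_update_le I K w y (w y)
  have hh2 := hopFrom_update_le I (K.update y (w y)) w z (w z)
  have hnp : ¬ ∀ v, ¬ PredMandatory I K v := fun hc => hc v (hv.predMandatory hE hw hK)
  by_cases hy : w y ∈ ival I K v
  · obtain ⟨c', rfl, hb⟩ := hin hy
    have hK2 := (hK.update y).update z
    have hopt := (hv.mustQuery hE hw hK hy).optFrom_update hw hK2
      (update_eq_none.2 ⟨hvz, update_eq_none.2 ⟨hv.1.symm, hv.2.2.1⟩⟩)
    have hh3 := hopFrom_update_le I ((K.update y (w y)).update z (w z)) w v (w v)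
    have h1 := hb.robust
    have h2 := hb.consistent
    set o := optFrom I (((K.update y (w y)).update z (w z)).update v (w v)) w
    set k := hopFrom I (((K.update y (w y)).update z (w z)).update v (w v)) w
    have h3 : g * (o + 2) ≤ g * optFrom I K w := Nat.mul_le_mul_left _ (by omega)
    have h4 : (g + 1) * (o + k + 2) ≤ (g + 1) * (optFrom I K w + hopFrom I K w) :=
      Nat.mul_le_mul_left _ (by omega)
    have h5 : g * (c' + 1 + 2) = g * c' + 3 * g := by ring
    have h6 : (g + 1) * (o + k + 2) = (g + 1) * (o + k) + 2 * g + 2 := by ring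
    have h7 : g * (o + 2) = g * o + 2 * g := by ring
    exact ⟨by omega, fun _ => by omega, by omega, fun hc => absurd hc hnp⟩
  · have hb := hout hy
    have hh3 := hopFrom_update_lt (w y) hv.1.symm hv.2.2.1 hv.2.1 (hv.hops hy) (Or.inr rfl)
    have h1 := hb.robust
    have h2 := hb.consistent
    set o := optFrom I ((K.update y (w y)).update z (w z)) w
    set k := hopFrom I ((K.update y (w y)).update z (w z)) w
    have h3 : g * (o + 1) ≤ g * optFrom I K w := Nat.mul_le_mul_left _ (by omega)
    have h4 : (g + 1) * (o + k + 2) ≤ (g + 1) * (optFrom I K w + hopFrom I K w) :=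
      Nat.mul_le_mul_left _ (by omega)
    have h5 : g * (c + 2) = g * c + 2 * g := by ring
    have h6 : (g + 1) * (o + k + 2) = (g + 1) * (o + k) + 2 * g + 2 := by ring
    have h7 : g * (o + 1) = g * o + g := by ring
    exact ⟨by omega, fun _ => by omega, by omega, fun hc => absurd hc hnp⟩

lemma StageBound.pairs_pair [Fintype V] {g : ℕ} {y v : V} {c : ℕ} (hg : 2 ≤ g)
    (hw : IsRealization I w) (hK : Agrees K w)
    (hno : ∀ y v z, Enforces I K y v → WitnessPair I K y z → v = z)
    (hv : Enforces I K y v) (h : StageBound I g w K c (.single v)) :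
    StageBound I g w K c .pairs := by
  intro hE
  obtain ⟨c', rfl, hb⟩ := h
  have hpos : 0 < optFrom I K w := hv.witnessPair.optFrom_pos
  have hp := hv.predMandatory hE hw hK
  have hpot := hp.potential_update hw hK
  have hnp : ¬ ∀ v, ¬ PredMandatory I K v := fun hc => hc v hp
  have hle := optFrom_update_le (I := I) hw hK v
  have hor := hv.optFrom_update_or hE (fun z => hno y v z hv) hw hK
  have h1 := hb.robust
  have h2 := hb.robust_exhaust
  have h3 := hb.consistent
  set o := optFrom I (K.update v (w v)) w
  set k := hopFrom I (K.update v (w v)) w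
  have h4 : (g + 1) * (o + k + 1) ≤ (g + 1) * (optFrom I K w + hopFrom I K w) :=
    Nat.mul_le_mul_left _ hpot
  have h5 : g * (c' + 1) = g * c' + g := by ring
  have h6 : (g + 1) * (o + k + 1) = (g + 1) * (o + k) + g + 1 := by ring
  -- Up to `g - 2` queries, `v`, and possibly one known mandatory vertex make at most `g` queries
  -- for one unit of optimum.
  have key : c' + 1 + g ≤ g * optFrom I K w + 2 := by
    rcases hor with hlt | hE'
    · have := Nat.mul_le_mul_left g hlt
      rw [mul_add g o] at this
      omega
    · have := Nat.mul_le_mul_left g hle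
      have := h2 hE'
      omega
  exact ⟨by omega, fun _ => key, by omega, fun hc => absurd hc hnp⟩

lemma StageBound.pairs_none [Fintype V] {g : ℕ} {c : ℕ} (hg : 2 ≤ g)
    (hw : IsRealization I w) (hK : Agrees K w) (hno : ∀ y v, ¬ Enforces I K y v)
    (h : StageBound I g w K c (.exhaust .test)) : StageBound I g w K c .pairs := by
  intro hE
  have hnp : ∀ v, ¬ PredMandatory I K v := fun v hv => by
    obtain ⟨y, v', he⟩ := hv.exists_enforces hE hw hK
    exact hno y v' he
  have h1 := h.consistent
  exact ⟨h.robust, fun h0 => h.robust_exit hE hnp h0, by omega, fun _ => h1⟩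

lemma StageBound.test_repeat [Fintype V] {g : ℕ} {v : V} {c : ℕ} (hg : 2 ≤ g)
    (hv : PredMandatory I K v) (h : StageBound I g w K c (.collect 0)) :
    StageBound I g w K c .test := by
  intro hE
  obtain ⟨ha, -, hc⟩ := h hE (by omega)
  exact ⟨ha, fun hn => absurd hE hn, fun _ hn => absurd hv (hn v), hc⟩

lemma StageBound.test_exit [Fintype V] {g : ℕ} {c : ℕ} (hg : 2 ≤ g)
    (hP : ∀ v, ¬ PredMandatory I K v) (h : StageBound I g w K c .cover) :
    StageBound I g w K c .test := by
  intro hE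
  obtain ⟨ha, hb⟩ := h hE hP
  have h1 : 2 * optFrom I K w ≤ g * optFrom I K w := Nat.mul_le_mul_right _ hg
  refine ⟨by omega, fun hn => absurd hE hn, fun _ _ h0 => ?_, ?_⟩
  · obtain ⟨d, rfl⟩ := Nat.exists_eq_add_of_le hg
    have : d ≤ d * optFrom I K w := Nat.le_mul_of_pos_right _ h0
    rw [add_mul]
    omega
  · exact Nat.mul_le_mul (by omega) hb

lemma StageBound.cover [Fintype V] {g : ℕ} {C : Finset V} {c : ℕ}
    (hw : IsRealization I w) (hK : Agrees K w) (hC : IsMinVertexCover (vcGraph I K) C)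
    (h : StageBound I g w K c (.sweep C)) : StageBound I g w K c .cover := by
  intro hE hP
  have h1 := card_le_optFrom_of_isMinVertexCover hC hE hw hK
  have h2 := Finset.card_le_card (mustQueries_reveal_subset (I := I) (K := K) (w := w) C)
  have h3 := card_mustQueries_le_optFrom (I := I) hw hK
  have h4 := card_mustQueries_le_hopFrom hw hK hP
  simp only [StageBound] at h
  omega

lemma reveal_update_erase {C : Finset V} {v : V} (hv : v ∈ C) :
    (K.update v (w v)).reveal w (C.erase v) = K.reveal w C := by
  rw [← reveal_singleton, reveal_reveal, ← Finset.insert_eq, Finset.insert_erase hv]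

theorem Follows.stageBound [Fintype V] {g : ℕ} {s : Stage V} {t : QueryTree V} (hg : 2 ≤ g)
    (hw : IsRealization I w) (h : Follows I g s K t) (hK : Agrees K w) :
    StageBound I g w K (t.run w).length s := by
  induction h with
  | exhaust_query v next hv h ih =>
    exact StageBound.exhaust_query hg hw hK hv (ih _ (hw v) (hK.update v))
  | exhaust_done hE h ih => exact StageBound.exhaust_done hE (ih hK)
  | collect_query v next hq hv h ih =>
    exact StageBound.collect_query hw hK hq hv (ih _ (hw v) (hK.update v))
  | collect_done hq h ih => exact StageBound.collect_done hq (ih hK)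
  | pairs_triple y v z next hv hz hvz hin hout ihin ihout =>
    exact StageBound.pairs_triple hg hw hK hv hz hvz
      (fun hy => ihin _ (hw y) _ (hw z) hy ((hK.update y).update z))
      (fun hy => ihout _ (hw y) _ (hw z) hy ((hK.update y).update z))
  | pairs_pair y v hno hv h ih => exact StageBound.pairs_pair hg hw hK hno hv (ih hK)
  | pairs_none hno h ih => exact StageBound.pairs_none hg hw hK hno (ih hK)
  | single_query v next h ih => exact ⟨_, rfl, ih _ (hw v) (hK.update v)⟩
  | test_repeat v hv h ih => exact StageBound.test_repeat hg hv (ih hK)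
  | test_exit hP h ih => exact StageBound.test_exit hg hP (ih hK)
  | cover C hC h ih => exact StageBound.cover hw hK hC (ih hK)
  | @sweep_query C K v next hv h ih =>
    have := ih _ (hw v) (hK.update v)
    simp only [StageBound, reveal_update_erase hv, QueryTree.run, List.length_cons] at this ⊢
    have := Finset.card_erase_add_one hv
    omega
  | @sweep_done K t h ih =>
    have h1 : K.reveal w ∅ = K := by funext z; simp [Known.reveal]
    simpa only [StageBound, h1, Finset.card_empty, zero_add] using ih hK
  | finish => rfl

/-! ### Feasibility -/

/-- Every later state without known mandatory vertices has no unsolved hyperedge. -/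
def Settled (I : Input V) (K : Known V) (w : V → ℝ) : Prop :=
  ∀ K' : Known V, Agrees K' w → (∀ z, K' z = none → K z = none) → Exhausted I K' →
    ∀ S ∈ I.edges, Solved I K' S

/-- What has to hold in a control state so that the set of all queries becomes feasible. -/
def StageReady (I : Input V) (w : V → ℝ) (K : Known V) : Stage V → Prop
  | .exhaust .finish => Settled I K w
  | .exhaust (.collect _) => True
  | .exhaust .test => True
  | .exhaust _ => False
  | .collect _ => Exhausted I K
  | .pairs => Exhausted I K
  | .single _ => True
  | .test => Exhausted I K
  | .cover => Exhausted I K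
  | .sweep C => Settled I (K.reveal w C) w
  | .finish => Settled I K w ∧ Exhausted I K

theorem Follows.feasibleFrom {g : ℕ} {s : Stage V} {t : QueryTree V}
    (hw : IsRealization I w) (h : Follows I g s K t) (hK : Agrees K w)
    (hs : StageReady I w K s) : FeasibleFrom I K w (t.run w).toFinset := by
  have step : ∀ {K : Known V} {v : V} {next : ℝ → QueryTree V},
      FeasibleFrom I (K.update v (w v)) w ((next (w v)).run w).toFinset →
      FeasibleFrom I K w ((QueryTree.query v next).run w).toFinset := by
    intro K v next h
    rw [QueryTree.run, List.toFinset_cons]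
    exact h.of_update
  induction h with
  | @exhaust_query s K v next hv h ih =>
    refine step (ih _ (hw v) (hK.update v) ?_)
    cases s with
    | finish =>
      exact fun K' hK' hext => hs K' hK' fun z hz => (update_eq_none.1 (hext z hz)).2
    | _ => exact hs
  | @exhaust_done s K t hE h ih =>
    refine ih hK ?_
    cases s with
    | finish => exact ⟨hs, hE⟩
    | collect => exact hE
    | test => exact hE
    | _ => exact hs.elim
  | collect_query v next hq hv h ih => exact step (ih _ (hw v) (hK.update v) trivial)
  | collect_done hq h ih => exact ih hK hs
  | @pairs_triple K y v z next hv hz hvz hin hout ihin ihout =>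
    refine step (next := fun x => .query z fun x' => next x x')
      (step (next := fun x' => next (w y) x') ?_)
    by_cases hy : w y ∈ ival I K v
    · exact ihin _ (hw y) _ (hw z) hy ((hK.update y).update z) trivial
    · exact ihout _ (hw y) _ (hw z) hy ((hK.update y).update z) trivial
  | pairs_pair y v hno hv h ih => exact ih hK trivial
  | pairs_none hno h ih => exact ih hK trivial
  | single_query v next h ih => exact step (ih _ (hw v) (hK.update v) trivial)
  | test_repeat v hv h ih => exact ih hK hs
  | test_exit hP h ih => exact ih hK hs
  | cover C hC h ih =>
    exact ih hK fun K' hK' hext hE' S hS =>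
      hs.solved_of_isVertexCover hE' hw hK hK' hC.1 hext hS
  | @sweep_query C K v next hv h ih =>
    refine step (ih _ (hw v) (hK.update v) ?_)
    simpa only [StageReady, reveal_update_erase hv] using hs
  | @sweep_done K t h ih =>
    have h1 : K.reveal w ∅ = K := by funext z; simp [Known.reveal]
    exact ih hK (by simpa only [StageReady, h1] using hs)
  | @finish K =>
    have h1 : K.reveal w ∅ = K := by funext z; simp [Known.reveal]
    intro S hS
    simpa [QueryTree.run, h1] using hs.1 K hK (fun _ h => h) hs.2 S hS

/-! ### Implementations -/

/-- The recorded answers lie in the uncertainty intervals. -/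
def Consistent (I : Input V) (K : Known V) : Prop :=
  ∀ z x, K z = some x → x ∈ Set.Ioo (I.L z) (I.U z)

lemma Consistent.update (hK : Consistent I K) {v : V} {x : ℝ}
    (hx : x ∈ Set.Ioo (I.L v) (I.U v)) : Consistent I (K.update v x) := by
  intro z y h
  by_cases hz : z = v
  · subst hz
    rw [update_self] at h
    exact Option.some.inj h ▸ hx
  · rw [update_of_ne hz] at h
    exact hK z y h

lemma Consistent.isRealization_guess (hK : Consistent I K) : IsRealization I (guess I K) := by
  intro z
  rcases hz : K z with _ | y
  · simpa [guess, hz] using I.pred_mem z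
  · simpa [guess, hz] using hK z y hz

/-- Query trees for all possible answers to a query. -/
lemma exists_next {v : V} {P : ℝ → QueryTree V → Prop}
    (h : ∀ x ∈ Set.Ioo (I.L v) (I.U v), ∃ t, P x t) :
    ∃ next : ℝ → QueryTree V, ∀ x ∈ Set.Ioo (I.L v) (I.U v), P x (next x) :=
  -- Answers outside the interval cannot occur and are not constrained by `Follows`, so any tree
  -- serves there.
  ⟨fun x => if hx : x ∈ Set.Ioo (I.L v) (I.U v) then (h x hx).choose else .halt, fun x hx => by
    simp only [dif_pos hx]; exact (h x hx).choose_spec⟩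

section Existence

variable [Fintype V]

/-- The number of vertices that have not been queried. -/
def unqueried (K : Known V) : ℕ := (Finset.univ.filter fun v => K v = none).card

lemma unqueried_update_le (K : Known V) (v : V) (x : ℝ) :
    unqueried (K.update v x) ≤ unqueried K := by
  refine Finset.card_le_card fun z hz => ?_
  simp only [Finset.mem_filter, Finset.mem_univ, true_and, update_eq_none] at hz ⊢
  exact hz.2

lemma unqueried_update_lt {v : V} (hv : K v = none) (x : ℝ) :
    unqueried (K.update v x) < unqueried K := by
  refine Finset.card_lt_card ⟨fun z hz => ?_, fun hc => ?_⟩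
  · simp only [Finset.mem_filter, Finset.mem_univ, true_and, update_eq_none] at hz ⊢
    exact hz.2
  · have := @hc v (by simp [hv])
    simp [update_self] at this

lemma exists_isMinVertexCover (G : SimpleGraph V) : ∃ C, IsMinVertexCover G C := by
  obtain ⟨C, hC, hmin⟩ := (Finset.univ.filter fun C : Finset V =>
    G.IsVertexCover (C : Set V)).exists_min_image Finset.card
      ⟨Finset.univ, by simp [SimpleGraph.IsVertexCover]⟩
  simp only [Finset.mem_filter, Finset.mem_univ, true_and] at hC hmin
  exact ⟨C, hC, hmin⟩

lemma exists_follows_exhaust_finish (I : Input V) (g : ℕ) (K : Known V) :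
    ∃ t, Follows I g (.exhaust .finish) K t := by
  induction h : unqueried K using Nat.strong_induction_on generalizing K with
  | _ n ih =>
    subst h
    by_cases hE : Exhausted I K
    · exact ⟨_, .exhaust_done hE .finish⟩
    · simp only [Exhausted, not_forall, not_not] at hE
      obtain ⟨v, hv⟩ := hE
      obtain ⟨next, hn⟩ := exists_next (I := I) (v := v) fun x _ =>
        ih _ (unqueried_update_lt hv.eq_none x) _ rfl
      exact ⟨_, .exhaust_query v next hv hn⟩

lemma exists_follows_sweep (I : Input V) (g : ℕ) (C : Finset V) (K : Known V) :
    ∃ t, Follows I g (.sweep C) K t := by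
  induction h : C.card generalizing C K with
  | zero =>
    obtain ⟨t, ht⟩ := exists_follows_exhaust_finish I g K
    rw [Finset.card_eq_zero] at h
    subst h
    exact ⟨t, .sweep_done ht⟩
  | succ n ih =>
    obtain ⟨v, hv⟩ := Finset.card_pos.1 (h.symm ▸ Nat.succ_pos n : 0 < C.card)
    obtain ⟨next, hn⟩ := exists_next (I := I) (v := v) fun x _ =>
      ih (C.erase v) (K.update v x) (by rw [Finset.card_erase_of_mem hv]; omega)
    exact ⟨_, .sweep_query v next hv hn⟩

lemma exists_follows_cover (I : Input V) (g : ℕ) (K : Known V) :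
    ∃ t, Follows I g .cover K t := by
  obtain ⟨C, hC⟩ := exists_isMinVertexCover (vcGraph I K)
  obtain ⟨t, ht⟩ := exists_follows_sweep I g C K
  exact ⟨t, .cover C hC ht⟩

/-- The stages `collect` and `test` can be carried out from every state with fewer than `n` unqueried
vertices once the known mandatory vertices have been queried. -/
def CanFollow (I : Input V) (g n : ℕ) : Prop :=
  ∀ K : Known V, Consistent I K → unqueried K < n →
    (∀ q, ∃ t, Follows I g (.exhaust (.collect q)) K t) ∧ ∃ t, Follows I g (.exhaust .test) K t

lemma CanFollow.exists_single {g n : ℕ} (h : CanFollow I g n) (hK : Consistent I K) (v : V)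
    (hn : ∀ x, unqueried (K.update v x) < n) : ∃ t, Follows I g (.single v) K t := by
  obtain ⟨next, hnext⟩ := exists_next (I := I) (v := v) fun x hx =>
    (h _ (hK.update hx) (hn x)).2
  exact ⟨_, .single_query v next hnext⟩

/-- An enforced vertex guarantees that this stage makes a query, so the number of unqueried vertices
drops before the loop continues. -/
lemma CanFollow.exists_pairs {g : ℕ} (h : CanFollow I g (unqueried K)) (hK : Consistent I K)
    (he : ∃ y v, Enforces I K y v) : ∃ t, Follows I g .pairs K t := by
  by_cases ht : ∃ y v z, Enforces I K y v ∧ WitnessPair I K y z ∧ v ≠ z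
  · obtain ⟨y, v, z, hv, hz, hvz⟩ := ht
    have hlt : ∀ x x', unqueried ((K.update y x).update z x') < unqueried K := fun x x' =>
      (unqueried_update_le _ z x').trans_lt (unqueried_update_lt hv.2.1 x)
    have hnext : ∀ x ∈ Set.Ioo (I.L y) (I.U y), ∃ next : ℝ → QueryTree V,
        ∀ x' ∈ Set.Ioo (I.L z) (I.U z),
          (x ∈ ival I K v → Follows I g (.single v) ((K.update y x).update z x') (next x')) ∧
          (x ∉ ival I K v →
            Follows I g (.exhaust .test) ((K.update y x).update z x') (next x')) := by
      intro x hx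
      refine exists_next (P := fun x' t =>
          (x ∈ ival I K v → Follows I g (.single v) ((K.update y x).update z x') t) ∧
          (x ∉ ival I K v → Follows I g (.exhaust .test) ((K.update y x).update z x') t))
        fun x' hx' => ?_
      have hK' := (hK.update hx).update hx'
      by_cases hxv : x ∈ ival I K v
      · obtain ⟨t, ht⟩ := h.exists_single hK' v fun r =>
          (unqueried_update_le _ v r).trans_lt (hlt x x')
        exact ⟨t, fun _ => ht, fun hc => absurd hxv hc⟩
      · obtain ⟨t, ht⟩ := (h _ hK' (hlt x x')).2
        exact ⟨t, fun hc => absurd hc hxv, fun _ => ht⟩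
    have : Nonempty (ℝ → QueryTree V) := ⟨fun _ => .halt⟩
    choose! next hnext using hnext
    exact ⟨_, .pairs_triple y v z next hv hz hvz
      (fun x hx x' hx' => (hnext x hx x' hx').1) (fun x hx x' hx' => (hnext x hx x' hx').2)⟩
  · push Not at ht
    obtain ⟨y, v, hv⟩ := he
    obtain ⟨t, hf⟩ := h.exists_single hK v (unqueried_update_lt hv.2.2.1)
    exact ⟨t, .pairs_pair y v ht hv hf⟩

lemma CanFollow.exists_collect_query {g q : ℕ} {v : V} (h : CanFollow I g (unqueried K))
    (hK : Consistent I K) (hq : q + 2 < g) (hv : PredMandatory I K v) :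
    ∃ t, Follows I g (.collect q) K t := by
  obtain ⟨next, hnext⟩ := exists_next (I := I) (v := v) fun x hx =>
    (h _ (hK.update hx) (unqueried_update_lt hv.eq_none x)).1 (q + 1)
  exact ⟨_, .collect_query v next hq hv hnext⟩

/-- A repetition cannot be idle: a prediction mandatory vertex is queried in `collect`, or, if `g ≤
2` forbids this, it yields an enforced vertex for `pairs`. -/
lemma CanFollow.exists_test {g : ℕ} (h : CanFollow I g (unqueried K)) (hK : Consistent I K)
    (hE : Exhausted I K) : ∃ t, Follows I g .test K t := by
  by_cases hP : ∃ v, PredMandatory I K v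
  · obtain ⟨v, hv⟩ := hP
    suffices ht : ∃ t, Follows I g (.collect 0) K t by
      obtain ⟨t, ht⟩ := ht
      exact ⟨t, .test_repeat v hv ht⟩
    by_cases hg : 0 + 2 < g
    · exact h.exists_collect_query hK hg hv
    · obtain ⟨t, ht⟩ := h.exists_pairs hK
        (hv.exists_enforces hE hK.isRealization_guess (agrees_guess I K))
      exact ⟨t, .collect_done (Or.inl (not_lt.1 hg)) ht⟩
  · obtain ⟨t, ht⟩ := exists_follows_cover I g K
    exact ⟨t, .test_exit (not_exists.1 hP) ht⟩

lemma CanFollow.exists_collect {g : ℕ} (h : CanFollow I g (unqueried K)) (hK : Consistent I K)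
    (hE : Exhausted I K) (q : ℕ) : ∃ t, Follows I g (.collect q) K t := by
  by_cases hP : q + 2 < g ∧ ∃ v, PredMandatory I K v
  · obtain ⟨hq, v, hv⟩ := hP
    exact h.exists_collect_query hK hq hv
  · suffices ht : ∃ t, Follows I g .pairs K t by
      obtain ⟨t, ht⟩ := ht
      refine ⟨t, .collect_done ?_ ht⟩
      rwa [not_and_or, not_lt, not_exists] at hP
    by_cases he : ∃ y v, Enforces I K y v
    · exact h.exists_pairs hK he
    · obtain ⟨t, ht⟩ := h.exists_test hK hE
      push Not at he
      exact ⟨t, .pairs_none he (.exhaust_done hE ht)⟩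

lemma canFollow (I : Input V) (g n : ℕ) : CanFollow I g n := by
  induction n with
  | zero => exact fun K _ h => absurd h (Nat.not_lt_zero _)
  | succ n ih =>
    intro K hK hn
    have h : CanFollow I g (unqueried K) := fun K' hK' hlt => ih K' hK' (by omega)
    by_cases hE : Exhausted I K
    · refine ⟨fun q => ?_, ?_⟩
      · obtain ⟨t, ht⟩ := h.exists_collect hK hE q
        exact ⟨t, .exhaust_done hE ht⟩
      · obtain ⟨t, ht⟩ := h.exists_test hK hE
        exact ⟨t, .exhaust_done hE ht⟩
    · simp only [Exhausted, not_forall, not_not] at hE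
      obtain ⟨v, hv⟩ := hE
      have hlt := unqueried_update_lt hv.eq_none
      refine ⟨fun q => ?_, ?_⟩
      · obtain ⟨next, hnext⟩ := exists_next (I := I) (v := v) fun x hx =>
          (h _ (hK.update hx) (hlt x)).1 q
        exact ⟨_, .exhaust_query v next hv hnext⟩
      · obtain ⟨next, hnext⟩ := exists_next (I := I) (v := v) fun x hx =>
          (h _ (hK.update hx) (hlt x)).2
        exact ⟨_, .exhaust_query v next hv hnext⟩

end Existence

theorem exists_implements (g : ℕ) : ∃ A : DetAlg.{u}, Implements g A := by
  have h : ∀ (V : Type u) [Fintype V] (I : Input V),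
      ∃ t, Follows I g (.exhaust (.collect 0)) (Known.initial V) t := fun V _ I =>
    (canFollow I g _ (Known.initial V) (fun _ _ h => by cases h) (Nat.lt_succ_self _)).1 0
  exact ⟨fun V _ I => (h V I).choose, fun V _ I => (h V I).choose_spec⟩

/-! ### Competitive ratio -/

lemma agrees_initial (w : V → ℝ) : Agrees (Known.initial V) w := fun _ _ h => by cases h

lemma hopFrom_initial [Fintype V] (I : Input V) (w : V → ℝ) :
    hopFrom I (Known.initial V) w = hopDistance I w := by
  unfold hopFrom hopDistance
  rw [Finset.card_filter, ← Finset.univ_product_univ, Finset.sum_product, Finset.sum_comm]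
  refine Finset.sum_congr rfl fun v _ => ?_
  rw [← Finset.sum_erase Finset.univ (a := v) (by simp)]
  refine Finset.sum_congr rfl fun z hz => ?_
  have : z ≠ v := Finset.ne_of_mem_erase hz
  simp [this, Known.initial]

lemma Implements.feasible {g : ℕ} {A : DetAlg.{u}} (hA : Implements g A) [Fintype V]
    (hw : IsRealization I w) : Feasible I w ((A V I).run w).toFinset :=
  (hA V I).feasibleFrom hw (agrees_initial w) trivial

lemma Implements.length_le {g : ℕ} {A : DetAlg.{u}} (hA : Implements g A) (hg : 2 ≤ g) [Fintype V]
    (hw : IsRealization I w) :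
    ((A V I).run w).length ≤ g * optCard I w ∧
    g * ((A V I).run w).length ≤ (g + 1) * (optCard I w + hopDistance I w) := by
  obtain ⟨h1, -, h2⟩ := (hA V I).stageBound hg hw (agrees_initial w) hg
  rw [hopFrom_initial] at h2
  exact ⟨h1, h2⟩

lemma expectedQueries_roundRandomly (A : ℕ → DetAlg.{u}) (γ : ℝ) [Fintype V] (I : Input V)
    (w : V → ℝ) : (roundRandomly A γ).expectedQueries I w =
      ENNReal.ofReal (Int.fract γ * ((A ⌈γ⌉₊ V I).run w).length +
        (1 - Int.fract γ) * ((A ⌊γ⌋₊ V I).run w).length) := by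
  have h0 := Int.fract_nonneg γ
  have h1 : 0 ≤ 1 - Int.fract γ := by linarith [Int.fract_lt_one γ]
  have h2 : ∀ f : Bool → DetAlg.{u}, RandAlg.expectedQueries ((fractCoin γ).map f) I w =
      ∑ b : Bool, fractCoin γ b * (((f b V I).run w).length : ℝ≥0∞) := by
    intro f
    simp only [RandAlg.expectedQueries, PMF.map_apply, tsum_fintype, Finset.sum_mul]
    rw [Summable.tsum_finsetSum fun _ _ => ENNReal.summable]
    refine Finset.sum_congr rfl fun b _ => ?_
    rw [tsum_eq_single (f b) fun a ha => by simp [ha]]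
    simp
  rw [roundRandomly, h2, ENNReal.ofReal_add (by positivity) (by positivity),
    ENNReal.ofReal_mul h0, ENNReal.ofReal_mul h1]
  simp [fractCoin]

/-- The excess of the mean of `1 / g` for a random rounding `g` of `γ` over `1 / γ`. -/
def roundingExcess (γ : ℝ) : ℝ :=
  Int.fract γ / (⌊γ⌋₊ + 1) + (1 - Int.fract γ) / ⌊γ⌋₊ - 1 / γ

lemma floor_add_fract_eq {γ : ℝ} (hγ : 0 ≤ γ) : (⌊γ⌋₊ : ℝ) + Int.fract γ = γ := by
  rw [natCast_floor_eq_intCast_floor hγ]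
  exact Int.floor_add_fract γ

lemma roundingExcess_mem {γ : ℝ} (hγ : 2 ≤ γ) : roundingExcess γ ∈ Set.Icc 0 (1 / 48) := by
  have hf0 := Int.fract_nonneg γ
  have hf1 := (Int.fract_lt_one γ).le
  have hn : (2 : ℝ) ≤ ⌊γ⌋₊ := by exact_mod_cast Nat.le_floor (by exact_mod_cast hγ)
  have hs := floor_add_fract_eq (γ := γ) (by linarith)
  unfold roundingExcess
  set n : ℝ := (⌊γ⌋₊ : ℝ)
  set f := Int.fract γ
  -- With `f * (1 - f) ≤ 1 / 4` and a denominator of at least `2 * 3 * 2 = 12`, this form gives `1 /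
  -- 48`.
  have heq : f / (n + 1) + (1 - f) / n - 1 / γ = f * (1 - f) / (n * (n + 1) * (n + f)) := by
    rw [← hs]
    have : n + f ≠ 0 := by linarith
    have : n ≠ 0 := by linarith
    have : n + 1 ≠ 0 := by linarith
    field_simp
    ring
  rw [heq]
  have hf : 0 ≤ f * (1 - f) := mul_nonneg hf0 (by linarith)
  refine ⟨by positivity, ?_⟩
  have hden : 12 ≤ n * (n + 1) * (n + f) := by
    have : 6 ≤ n * (n + 1) := by nlinarith
    nlinarith
  rw [div_le_div_iff₀ (by linarith) (by norm_num)]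
  nlinarith [sq_nonneg (2 * f - 1)]

lemma achievesRatio_roundRandomly {γ : ℝ} (hγ : 2 ≤ γ) {A : ℕ → DetAlg.{u}}
    (hA : ∀ g, 2 ≤ g → Implements g (A g)) :
    (roundRandomly A γ).AchievesRatio fun V _ I w =>
      min ((1 + 1 / γ + roundingExcess γ) *
        (1 + (hopDistance I w : ℝ) / (optCard I w : ℝ))) γ := by
  intro V _ I w hw
  have hfl : 2 ≤ ⌊γ⌋₊ := Nat.le_floor (by exact_mod_cast hγ)
  have hcl : 2 ≤ ⌈γ⌉₊ := hfl.trans (Nat.floor_le_ceil γ)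
  refine ⟨fun a ha => ?_, ?_⟩
  · obtain ⟨b, -, rfl⟩ := (PMF.mem_support_map_iff _ _ _).1 ha
    cases b
    · exact (hA _ hfl).feasible hw
    · exact (hA _ hcl).feasible hw
  rw [expectedQueries_roundRandomly]
  refine ENNReal.ofReal_le_ofReal ?_
  obtain ⟨ha, hb⟩ := (hA _ hfl).length_le (I := I) hfl hw
  obtain ⟨hc, hd⟩ := (hA _ hcl).length_le (I := I) hcl hw
  have hf0 := Int.fract_nonneg γ
  have hf1 : 0 ≤ 1 - Int.fract γ := by linarith [Int.fract_lt_one γ]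
  have hs := floor_add_fract_eq (γ := γ) (by linarith)
  -- For integral `γ` the ceiling is not `⌊γ⌋₊ + 1`, but then its term has weight zero.
  have hceil : Int.fract γ = 0 ∨ (⌈γ⌉₊ : ℝ) = ⌊γ⌋₊ + 1 := by
    rcases hf0.eq_or_lt with h | h
    · exact Or.inl h.symm
    · right
      have h1 : ⌈γ⌉₊ ≤ ⌊γ⌋₊ + 1 := Nat.ceil_le_floor_add_one γ
      have h2 : ⌊γ⌋₊ < ⌈γ⌉₊ := Nat.lt_ceil.2 (by linarith)
      exact_mod_cast le_antisymm h1 h2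
  set c₁ := ((A ⌊γ⌋₊ V I).run w).length
  set c₂ := ((A ⌈γ⌉₊ V I).run w).length
  have ha' : (c₁ : ℝ) ≤ ⌊γ⌋₊ * optCard I w := by exact_mod_cast ha
  have hc' : (c₂ : ℝ) ≤ ⌈γ⌉₊ * optCard I w := by exact_mod_cast hc
  have hb' : (⌊γ⌋₊ : ℝ) * c₁ ≤ (⌊γ⌋₊ + 1) * (optCard I w + hopDistance I w) := by
    exact_mod_cast hb
  have hd' : (⌈γ⌉₊ : ℝ) * c₂ ≤ (⌈γ⌉₊ + 1) * (optCard I w + hopDistance I w) := by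
    exact_mod_cast hd
  have hn : (2 : ℝ) ≤ ⌊γ⌋₊ := by exact_mod_cast hfl
  have hm : (2 : ℝ) ≤ ⌈γ⌉₊ := by exact_mod_cast hcl
  have hrobust : Int.fract γ * c₂ + (1 - Int.fract γ) * c₁ ≤ γ * optCard I w := by
    have h1 := mul_le_mul_of_nonneg_left hc' hf0
    have h2 := mul_le_mul_of_nonneg_left ha' hf1
    refine (add_le_add h1 h2).trans (le_of_eq ?_)
    rcases hceil with h | h
    · rw [h, add_zero] at hs
      rw [h, hs]
      ring
    · rw [h]
      conv_rhs => rw [← hs]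
      ring
  -- For optimum zero the quotient by `optCard` is meaningless; both sides vanish by robustness
  -- alone.
  rcases Nat.eq_zero_or_pos (optCard I w) with h0 | hpos
  · simpa [h0] using hrobust
  have hpos' : (0 : ℝ) < optCard I w := by exact_mod_cast hpos
  rw [min_mul_of_nonneg _ _ hpos'.le, mul_assoc, one_add_mul, div_mul_cancel₀ _ hpos'.ne']
  refine le_min ?_ hrobust
  set T : ℝ := optCard I w + hopDistance I w
  have hb2 : (c₁ : ℝ) ≤ (1 + 1 / ⌊γ⌋₊) * T := by
    rw [← mul_le_mul_iff_right₀ (show (0 : ℝ) < ⌊γ⌋₊ by linarith)]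
    refine hb'.trans (le_of_eq ?_)
    field_simp
  have hd2 : (c₂ : ℝ) ≤ (1 + 1 / ⌈γ⌉₊) * T := by
    rw [← mul_le_mul_iff_right₀ (show (0 : ℝ) < ⌈γ⌉₊ by linarith)]
    refine hd'.trans (le_of_eq ?_)
    field_simp
  have h1 := mul_le_mul_of_nonneg_left hd2 hf0
  have h2 := mul_le_mul_of_nonneg_left hb2 hf1
  refine (add_le_add h1 h2).trans (le_of_eq ?_)
  unfold roundingExcess
  rcases hceil with h | h
  · rw [h]; ring
  · rw [h]; ring

end HypOrient

end

theorem theorem3p5 (γ : ℝ) (hγ : 2 ≤ γ) :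
    ∃ ξ : ℝ, 0 ≤ ξ ∧ ξ ≤ 1 / 48 ∧
      ∃ A : ℕ → HypOrient.DetAlg.{u},
        (∀ g : ℕ, 2 ≤ g → HypOrient.Implements g (A g)) ∧
        (HypOrient.roundRandomly A γ).AchievesRatio (fun V _ I w =>
          min ((1 + 1 / γ + ξ) *
              (1 + (HypOrient.hopDistance I w : ℝ) / (HypOrient.optCard I w : ℝ))) γ) := by
  obtain ⟨h0, h1⟩ := HypOrient.roundingExcess_mem hγ
  choose A hA using HypOrient.exists_implements.{u}
  exact ⟨HypOrient.roundingExcess γ, h0, h1, A, fun g _ => hA g,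
    HypOrient.achievesRatio_roundRandomly hγ fun g _ => hA g⟩
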